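/- Let $M_1$ and $M_2$ be nonempty smooth manifolds of dimensions $m\ge 1$ and $n\ge 1$, with local coordinates $(x^1,\dots,x^m)$ on $M_1$. A Finsler metric on a smooth manifold $M$ is a function $F:TM\to[0,\infty)$ that is smooth on the slit tangent bundle $TM\setminus\{0\}$, satisfies $F(x,\lambda y)=\lambda F(x,y)$ for $\lambda>0$, and whose fundamental tensor $g_{ij}=[\tfrac12F^2]_{y^iy^j}$ is positive definite on $TM\setminus\{0\}$. With $(g^{ij})=(g_{ij})^{-1}$, let $C_{ijk}=\tfrac12\,\partial g_{ij}/\partial y^k$ be its Cartan torsion, $C^p_{ij}=g^{pk}C_{kij}$, let $G^i=\tfrac14 g^{ip}\big([F^2]_{x^qy^p}y^q-[F^2]_{x^p}\big)$ be its spray coefficients and $L_{ijk}=-\tfrac12 F F_{y^l}\,\dfrac{\partial^3G^l}{\partial y^i\partial y^j\partial y^k}$ its Landsberg curvature. $F$ is called a Landsberg metric if $L_{ijk}=0$ wherever $F$ is considered (for a Finsler metric on $M$: on $TM\setminus\{0\}$), and Riemannian if $F^2$ is a quadratic form on each tangent space. Let $F_1$, $F_2$ be Finsler metrics on $M_1$,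 $M_2$, let $f:M_1\times M_2\to(0,\infty)$ be smooth, and let $$F=\sqrt{F_1^2+f^2F_2^2},$$ considered on the set of tangent vectors $(y_1,y_2)$ of $M_1\times M_2$ with $y_1\neq0$ and $y_2\neq 0$, be the twisted product of $F_1$ and $F_2$. Consider the three conditions: $F_1$ is a Landsberg metric; $F_2$ is Riemannian; and $$\sum_{p=1}^m C^p_{ij}(x_1,y_1)\,\frac{\partial f}{\partial x^p}(x_1,x_2)=0\qquad(1\le i,j\le m)$$ for all $x_1\in M_1$, $0\ne y_1\in T_{x_1}M_1$, $x_2\in M_2$, where $C$ is the Cartan torsion of $F_1$. (a) If the three conditions hold, then $F$ is a Landsberg metric. (b) Suppose that for every $x_2\in M_2$ there is $x_1\in M_1$ at which the differential of $f(\cdot,x_2)$ is nonzero, and that $n\ge2$, or $n=1$ and $F_2$ is reversible ($F_2(-v)=F_2(v)$). Then $F$ is a Landsberg metric if and only if the three conditions hold. -/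

import Mathlib

open scoped Manifold ContDiff

noncomputable section

namespace Finsler

/-! ### Coordinate formulas

`E` is the coordinate space, with basis `b`; a function `Φ : E → E → ℝ` of the position `x` and the
velocity `y` stands for a function on (an open subset of) the tangent bundle of `E`, in the induced
coordinates `(x^i, y^i)`. -/

section Coordinates

variable {E : Type*} [NormedAddCommGroup E] [NormedSpace ℝ E]
  {ι : Type*} [Fintype ι] [DecidableEq ι]

/-- The partial derivative of `Φ` in the position variable, in the direction `u`. -/
def dx (u : E) (Φ : E → E → ℝ) (x y : E) : ℝ := fderiv ℝ (fun x' => Φ x' y) x u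

/-- The partial derivative of `Φ` in the velocity variable, in the direction `u`. -/
def dy (u : E) (Φ : E → E → ℝ) (x y : E) : ℝ := fderiv ℝ (fun y' => Φ x y') y u

/-- The fundamental tensor `g_{ij} = [F² / 2]_{y^i y^j}`. -/
def fundamentalTensor (b : Module.Basis ι ℝ E) (F : E → E → ℝ) (x y : E) : Matrix ι ι ℝ :=
  Matrix.of fun i j => dy (b j) (dy (b i) (fun x y => (1 / 2) * F x y ^ 2)) x y

/-- The Cartan torsion `C_{ijk} = (1/2) ∂g_{ij}/∂y^k`. -/
def cartanTorsion (b : Module.Basis ι ℝ E) (F : E → E → ℝ) (i j k : ι) (x y : E) : ℝ :=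
  (1 / 2) * dy (b k) (fun x y => fundamentalTensor b F x y i j) x y

/-- The Cartan torsion with one index raised, `C^p_{ij} = g^{pk} C_{kij}`. -/
def cartanTorsionRaised (b : Module.Basis ι ℝ E) (F : E → E → ℝ) (p i j : ι) (x y : E) : ℝ :=
  ∑ k, (fundamentalTensor b F x y)⁻¹ p k * cartanTorsion b F k i j x y

/-- The spray coefficients `G^i = (1/4) g^{ip} ([F²]_{x^q y^p} y^q - [F²]_{x^p})`. -/
def sprayCoeff (b : Module.Basis ι ℝ E) (F : E → E → ℝ) (i : ι) (x y : E) : ℝ :=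
  (1 / 4) * ∑ p, (fundamentalTensor b F x y)⁻¹ i p *
    ((∑ q, dy (b p) (dx (b q) (fun x y => F x y ^ 2)) x y * b.repr y q)
      - dx (b p) (fun x y => F x y ^ 2) x y)

/-- The Berwald curvature `B_i^l_{jk} = ∂³G^l / ∂y^i ∂y^j ∂y^k`. -/
def berwaldCurvature (b : Module.Basis ι ℝ E) (F : E → E → ℝ) (l i j k : ι) (x y : E) : ℝ :=
  dy (b k) (dy (b j) (dy (b i) (sprayCoeff b F l))) x y

/-- The Landsberg curvature `L_{ijk} = -(1/2) F F_{y^l} B_i^l_{jk}`. -/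
def landsbergCurvature (b : Module.Basis ι ℝ E) (F : E → E → ℝ) (i j k : ι) (x y : E) : ℝ :=
  -(1 / 2) * ∑ l, F x y * dy (b l) F x y * berwaldCurvature b F l i j k x y

end Coordinates

/-! ### Functions on the tangent bundle of a manifold -/

section Manifolds

variable {E : Type*} [NormedAddCommGroup E] [NormedSpace ℝ E] {H : Type*} [TopologicalSpace H]
  (I : ModelWithCorners ℝ E H) {M : Type*} [TopologicalSpace M] [ChartedSpace H M]
  {ι : Type*} [Fintype ι] [DecidableEq ι]

/-- The tangent vector `y^i ∂/∂x^i` at the point with coordinates `x`, in the chart at `a`: the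
image of `y` under the differential of the inverse chart at `x`. -/
def coordVector (a : M) (x y : E) : TangentBundle I M :=
  tangentMap 𝓘(ℝ, E) I (extChartAt I a).symm ⟨x, y⟩

/-- The function `F` in the coordinates `(x, y)` that the chart at `a` induces. -/
def localRep (F : TangentBundle I M → ℝ) (a : M) (x y : E) : ℝ := F (coordVector I a x y)

/-- `L_{ijk} = 0` at all points of the subset `D` of the tangent bundle, in all charts `chartAt`
(for a product manifold, these are the products of charts of the factors). -/
def IsLandsbergOn (b : Module.Basis ι ℝ E) (F : TangentBundle I M → ℝ)
    (D : Set (TangentBundle I M)) : Prop :=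
  ∀ a : M, ∀ x ∈ (extChartAt I a).target, ∀ y : E, coordVector I a x y ∈ D →
    ∀ i j k : ι, landsbergCurvature b (localRep I F a) i j k x y = 0

end Manifolds

/-- The standard basis of `ℝⁿ`. -/
abbrev stdBasis (n : ℕ) : Module.Basis (Fin n) ℝ (EuclideanSpace ℝ (Fin n)) :=
  (EuclideanSpace.basisFun (Fin n) ℝ).toBasis

/-- A Finsler metric on an `n`-dimensional smooth manifold. -/
structure FinslerMetric (n : ℕ) (M : Type*) [TopologicalSpace M]
    [ChartedSpace (EuclideanSpace ℝ (Fin n)) M] [IsManifold (𝓡 n) ∞ M] where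
  /-- The underlying function on the tangent bundle. -/
  toFun : TangentBundle (𝓡 n) M → ℝ
  nonneg : ∀ v, 0 ≤ toFun v
  smooth : ContMDiffOn (𝓡 n).tangent 𝓘(ℝ, ℝ) ∞ toFun {v | v.snd ≠ 0}
  homogeneous : ∀ (p : M) (v : TangentSpace (𝓡 n) p) (c : ℝ), 0 < c →
    toFun ⟨p, c • v⟩ = c * toFun ⟨p, v⟩
  posDef : ∀ a : M, ∀ x ∈ (extChartAt (𝓡 n) a).target, ∀ y : EuclideanSpace ℝ (Fin n), y ≠ 0 →
    (fundamentalTensor (stdBasis n) (localRep (𝓡 n) toFun a) x y).PosDef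

namespace FinslerMetric

variable {n : ℕ} {M : Type*} [TopologicalSpace M]
  [ChartedSpace (EuclideanSpace ℝ (Fin n)) M] [IsManifold (𝓡 n) ∞ M]

/-- The Landsberg curvature vanishes on the slit tangent bundle. -/
def IsLandsberg (F : FinslerMetric n M) : Prop :=
  IsLandsbergOn (𝓡 n) (stdBasis n) F.toFun {v | v.snd ≠ 0}

/-- `F² = g_{ij}(x) y^i y^j`: on each tangent space, `F²` is a quadratic form. (It is positive
definite and depends smoothly on the point because `F` is a Finsler metric.) -/
def IsRiemannian (F : FinslerMetric n M) : Prop :=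
  ∀ p : M, ∃ Q : QuadraticForm ℝ (TangentSpace (𝓡 n) p), ∀ v : TangentSpace (𝓡 n) p,
    F.toFun ⟨p, v⟩ ^ 2 = Q v

/-- `F(-v) = F(v)` for all tangent vectors `v`. -/
def IsReversible (F : FinslerMetric n M) : Prop :=
  ∀ (p : M) (v : TangentSpace (𝓡 n) p), F.toFun ⟨p, -v⟩ = F.toFun ⟨p, v⟩

end FinslerMetric

section TwistedProduct

variable {m n : ℕ} {M₁ : Type*} [TopologicalSpace M₁]
  [ChartedSpace (EuclideanSpace ℝ (Fin m)) M₁] [IsManifold (𝓡 m) ∞ M₁]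
  {M₂ : Type*} [TopologicalSpace M₂]
  [ChartedSpace (EuclideanSpace ℝ (Fin n)) M₂] [IsManifold (𝓡 n) ∞ M₂]

/-- The twisted product `F = √(F₁² + f² F₂²)` on the tangent bundle of `M₁ × M₂`. -/
def twistedProduct (F₁ : FinslerMetric m M₁) (F₂ : FinslerMetric n M₂) (f : M₁ × M₂ → ℝ)
    (v : TangentBundle ((𝓡 m).prod (𝓡 n)) (M₁ × M₂)) : ℝ :=
  Real.sqrt (F₁.toFun (tangentMap ((𝓡 m).prod (𝓡 n)) (𝓡 m) Prod.fst v) ^ 2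
    + f v.proj ^ 2 * F₂.toFun (tangentMap ((𝓡 m).prod (𝓡 n)) (𝓡 n) Prod.snd v) ^ 2)

variable (m n M₁ M₂) in
/-- The domain of the twisted product: the tangent vectors of `M₁ × M₂` both of whose components
are nonzero. -/
def slitProduct : Set (TangentBundle ((𝓡 m).prod (𝓡 n)) (M₁ × M₂)) :=
  {v | (tangentMap ((𝓡 m).prod (𝓡 n)) (𝓡 m) Prod.fst v).snd ≠ 0 ∧
    (tangentMap ((𝓡 m).prod (𝓡 n)) (𝓡 n) Prod.snd v).snd ≠ 0}

/-- The Landsberg curvature of the twisted product vanishes on the domain of that metric. -/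
def TwistedProductIsLandsberg (F₁ : FinslerMetric m M₁) (F₂ : FinslerMetric n M₂)
    (f : M₁ × M₂ → ℝ) : Prop :=
  IsLandsbergOn ((𝓡 m).prod (𝓡 n)) ((stdBasis m).prod (stdBasis n)) (twistedProduct F₁ F₂ f)
    (slitProduct m n M₁ M₂)

/-- `C^p_{ij}(x₁, y₁) ∂f/∂x^p (x₁, x₂) = 0` for all `x₁`, all `y₁ ≠ 0` and all `x₂`, where `C` is
the Cartan torsion of `F₁` and `p` runs over the coordinates of `M₁`. -/
def CartanContractionVanishes (F₁ : FinslerMetric m M₁) (f : M₁ × M₂ → ℝ) : Prop :=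
  ∀ (q : M₂) (a : M₁), ∀ x ∈ (extChartAt (𝓡 m) a).target, ∀ y : EuclideanSpace ℝ (Fin m), y ≠ 0 →
    ∀ i j : Fin m, ∑ p, cartanTorsionRaised (stdBasis m) (localRep (𝓡 m) F₁.toFun a) p i j x y *
      fderiv ℝ (fun x' => f ((extChartAt (𝓡 m) a).symm x', q)) x (stdBasis m p) = 0

end TwistedProduct

end Finsler

end

/-! In product coordinates write `h = f²`, a velocity as `(y, v)`, and `K^l = g₁^{lp} h_p` for the
part of `dh` along `M₁` with its index raised by the fundamental tensor of `F₁`. Since `F² = F₁² + h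
F₂²`, the fundamental tensor is block diagonal with blocks `g₁` and `h g₂`, and each spray
coefficient is a sum of two products of a function of `y` and a function of `v`: `G^l = G₁^l - (1/4)
K^l F₂²` along `M₁`, and `G^α = R^α(v) + dh(y) v^α / (2h)` along `M₂`, with `R` the `twistedSpray`.

Because `F F_{y^l} = (1/2) [F²]_{y^l}`, the Landsberg curvature is a contraction of `[F²]_{y^l}`
with third velocity derivatives of the spray, so it can be read off component by component. The
identity `[F₁²]_{y^l} ∂_i ∂_j K^l = 4 C^p_{ij} h_p`, obtained by differentiating `[F₁²]_{y^l} K^l =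
2 h_p y^p` twice, ties `K` to the Cartan torsion.

Sufficiency: the torsion condition makes `K` independent of `y`, and a Riemannian `F₂` makes `R`
quadratic in `v`. All third derivatives then drop out except those giving the Landsberg curvature of
`F₁`.

Necessity: the component with two indices in `M₁` is `(1/4) [F₂²]_{v^k} C^p_{ij} h_p`, which forces
the torsion condition (`cartan_contract_eq_zero`). The component with all indices in `M₁` is then
the curvature of `F₁` (`landsbergCurvature_left`). The component with all indices in `M₂` is `(1/8)
dh(y) [F₂²]_{v^i v^j v^k}` plus a term free of `y`; comparing `y` with `-y` where `dh(y) ≠ 0` kills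
the third derivatives of `F₂²`. For `n ≥ 2` the slit tangent space is connected, so `g₂` is constant
on it and `F₂` is Riemannian. On a line the two half-lines are separated, and reversibility makes
the values there match. -/

noncomputable section

namespace Finsler

set_option linter.unusedSectionVars false

/-! ### Directional derivatives, and mixed position and velocity derivatives. -/

section Calculus

variable {E : Type*} [NormedAddCommGroup E] [NormedSpace ℝ E]
  {E' : Type*} [NormedAddCommGroup E'] [NormedSpace ℝ E']

/-- The derivative of `φ` in the direction `u`. -/
def dirDeriv (u : E) (φ : E → ℝ) (y : E) : ℝ := fderiv ℝ φ y u

theorem dy_eq_dirDeriv (u : E) (Φ : E → E → ℝ) (x : E) : dy u Φ x = dirDeriv u (Φ x) := rfl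

theorem dirDeriv_congr {U : Set E} (hU : IsOpen U) {φ ψ : E → ℝ} (h : Set.EqOn φ ψ U) (u : E) :
    Set.EqOn (dirDeriv u φ) (dirDeriv u ψ) U := fun y hy => by
  unfold dirDeriv
  rw [(Filter.eventuallyEq_of_mem (hU.mem_nhds hy) h).fderiv_eq]

theorem _root_.ContDiffOn.dirDeriv {U : Set E} (hU : IsOpen U) {φ : E → ℝ}
    (h : ContDiffOn ℝ ∞ φ U) (u : E) : ContDiffOn ℝ ∞ (dirDeriv u φ) U :=
  (h.fderiv_of_isOpen hU (by simp)).clm_apply contDiffOn_const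

theorem _root_.ContDiffOn.differentiableAt_of_isOpen {U : Set E} {φ : E → E'}
    (h : ContDiffOn ℝ ∞ φ U) (hU : IsOpen U) {y : E} (hy : y ∈ U) : DifferentiableAt ℝ φ y :=
  (h.contDiffAt (hU.mem_nhds hy)).differentiableAt (by simp)

@[simp] theorem dirDeriv_const (u : E) (c : ℝ) : dirDeriv u (fun _ => c) = fun _ => 0 := by
  ext y; simp [dirDeriv]

@[simp] theorem dirDeriv_clm (u : E) (l : E →L[ℝ] ℝ) :
    dirDeriv u (fun y => l y) = fun _ => l u := by
  ext y; simp [dirDeriv]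

@[simp] theorem dirDeriv_zero_dir (φ : E → ℝ) : dirDeriv (0 : E) φ = fun _ => 0 := by
  ext y; simp [dirDeriv]

theorem dirDeriv_add {φ ψ : E → ℝ} {y : E} (hφ : DifferentiableAt ℝ φ y)
    (hψ : DifferentiableAt ℝ ψ y) (u : E) :
    dirDeriv u (fun y => φ y + ψ y) y = dirDeriv u φ y + dirDeriv u ψ y := by
  simp [dirDeriv, fderiv_fun_add hφ hψ]

theorem dirDeriv_mul {φ ψ : E → ℝ} {y : E} (hφ : DifferentiableAt ℝ φ y)
    (hψ : DifferentiableAt ℝ ψ y) (u : E) :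
    dirDeriv u (fun y => φ y * ψ y) y = dirDeriv u φ y * ψ y + φ y * dirDeriv u ψ y := by
  simp [dirDeriv, fderiv_fun_mul hφ hψ]; ring

@[simp] theorem dirDeriv_const_mul (c : ℝ) (φ : E → ℝ) (u : E) :
    dirDeriv u (fun y => c * φ y) = fun y => c * dirDeriv u φ y := by
  ext y
  have h := fderiv_const_smul_field (𝕜 := ℝ) (f := φ) c
  simp only [dirDeriv]
  rw [show (fun y => c * φ y) = c • φ from rfl, h]; simp

theorem dirDeriv_sum {ι : Type*} {s : Finset ι} {φ : ι → E → ℝ} {y : E}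
    (h : ∀ i ∈ s, DifferentiableAt ℝ (φ i) y) (u : E) :
    dirDeriv u (fun y => ∑ i ∈ s, φ i y) y = ∑ i ∈ s, dirDeriv u (φ i) y := by
  simp [dirDeriv, fderiv_fun_sum h]

theorem dirDeriv_dirDeriv_comm {U : Set E} (hU : IsOpen U) {φ : E → ℝ} (h : ContDiffOn ℝ ∞ φ U)
    (u v : E) {y : E} (hy : y ∈ U) :
    dirDeriv u (dirDeriv v φ) y = dirDeriv v (dirDeriv u φ) y := by
  have hd : DifferentiableAt ℝ (fderiv ℝ φ) y :=
    (h.fderiv_of_isOpen (m := ∞) hU (by simp)).differentiableAt_of_isOpen hU hy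
  have key (a b : E) : dirDeriv a (dirDeriv b φ) y = fderiv ℝ (fderiv ℝ φ) y a b := by
    unfold dirDeriv
    rw [fderiv_clm_apply hd (differentiableAt_const _)]
    simp
  rw [key, key]
  exact (h.contDiffAt (hU.mem_nhds hy)).isSymmSndFDerivAt
    (by simpa using (WithTop.coe_le_coe.2 le_top : ((2 : ℕ∞) : WithTop ℕ∞) ≤ ∞)) u v

/-- Reads a partial derivative as a directional derivative on `E × E`, where joint smoothness and
the symmetry of second derivatives are available. -/
theorem dx_eq_dirDeriv {Φ : E → E → ℝ} {x y : E}
    (h : DifferentiableAt ℝ (fun p : E × E => Φ p.1 p.2) (x, y)) (u : E) :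
    dx u Φ x y = dirDeriv (u, 0) (fun p : E × E => Φ p.1 p.2) (x, y) := by
  have := HasFDerivAt.comp (f := fun e => (e, y)) (g := fun p : E × E => Φ p.1 p.2)
    x (by exact h.hasFDerivAt) (hasFDerivAt_prodMk_left x y)
  unfold dx dirDeriv
  erw [this.fderiv]
  simp

theorem dy_eq_dirDeriv_prod {Φ : E → E → ℝ} {x y : E}
    (h : DifferentiableAt ℝ (fun p : E × E => Φ p.1 p.2) (x, y)) (u : E) :
    dy u Φ x y = dirDeriv (0, u) (fun p : E × E => Φ p.1 p.2) (x, y) := by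
  have := HasFDerivAt.comp (f := fun e => (x, e)) (g := fun p : E × E => Φ p.1 p.2)
    y (by exact h.hasFDerivAt) (hasFDerivAt_prodMk_right x y)
  unfold dy dirDeriv
  erw [this.fderiv]
  simp

section Mixed

variable {W : Set (E × E)} {Φ : E → E → ℝ}

theorem contDiffOn_dx (hW : IsOpen W) (h : ContDiffOn ℝ ∞ (fun p : E × E => Φ p.1 p.2) W) (u : E) :
    ContDiffOn ℝ ∞ (fun p : E × E => dx u Φ p.1 p.2) W :=
  (h.dirDeriv hW (u, 0)).congr fun _ hp => dx_eq_dirDeriv (h.differentiableAt_of_isOpen hW hp) u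

theorem contDiffOn_dy (hW : IsOpen W) (h : ContDiffOn ℝ ∞ (fun p : E × E => Φ p.1 p.2) W) (u : E) :
    ContDiffOn ℝ ∞ (fun p : E × E => dy u Φ p.1 p.2) W :=
  (h.dirDeriv hW (0, u)).congr fun _ hp =>
    dy_eq_dirDeriv_prod (h.differentiableAt_of_isOpen hW hp) u

/-- Directional derivatives in position and velocity commute. -/
theorem dx_dy_comm (hW : IsOpen W) (h : ContDiffOn ℝ ∞ (fun p : E × E => Φ p.1 p.2) W) (u v : E)
    {x y : E} (hxy : (x, y) ∈ W) : dx u (dy v Φ) x y = dy v (dx u Φ) x y := by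
  rw [dx_eq_dirDeriv ((contDiffOn_dy hW h v).differentiableAt_of_isOpen hW hxy),
    dy_eq_dirDeriv_prod ((contDiffOn_dx hW h u).differentiableAt_of_isOpen hW hxy),
    dirDeriv_congr hW (fun p hp => dy_eq_dirDeriv_prod (h.differentiableAt_of_isOpen hW hp) v)
      (u, 0) hxy,
    dirDeriv_congr hW (fun p hp => dx_eq_dirDeriv (h.differentiableAt_of_isOpen hW hp) u)
      (0, v) hxy]
  exact dirDeriv_dirDeriv_comm hW h _ _ hxy

end Mixed

theorem contDiffOn_slice {T V : Set E} {Φ : E → E → ℝ}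
    (h : ContDiffOn ℝ ∞ (fun p : E × E => Φ p.1 p.2) (T ×ˢ V)) {x : E} (hx : x ∈ T) :
    ContDiffOn ℝ ∞ (Φ x) V :=
  h.comp (f := fun y => (x, y)) (contDiffOn_const.prodMk contDiffOn_id) fun _ hy => ⟨hx, hy⟩

theorem contDiffOn_slice_left {T V : Set E} {Φ : E → E → ℝ}
    (h : ContDiffOn ℝ ∞ (fun p : E × E => Φ p.1 p.2) (T ×ˢ V)) {y : E} (hy : y ∈ V) :
    ContDiffOn ℝ ∞ (fun x => Φ x y) T :=
  h.comp (f := fun x => (x, y)) (contDiffOn_id.prodMk contDiffOn_const) fun _ hx => ⟨hx, hy⟩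

/-! ### Polynomial dependence on the velocity, expressed by vanishing derivatives. -/

/-- All derivatives of order `n` of `φ` vanish on `V`. -/
def DerivVanishOn (V : Set E) : ℕ → (E → ℝ) → Prop
  | 0, φ => ∀ y ∈ V, φ y = 0
  | n + 1, φ => ∀ u, DerivVanishOn V n (dirDeriv u φ)

namespace DerivVanishOn

variable {V : Set E}

theorem congr (hV : IsOpen V) {n : ℕ} {φ ψ : E → ℝ} (h : DerivVanishOn V n φ)
    (he : Set.EqOn φ ψ V) : DerivVanishOn V n ψ := by
  induction n generalizing φ ψ with
  | zero => exact fun y hy => (he hy).symm.trans (h y hy)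
  | succ n ih => exact fun u => ih (h u) (dirDeriv_congr hV he u)

theorem of_zero (hV : IsOpen V) {n : ℕ} {φ : E → ℝ} (h : DerivVanishOn V 0 φ) :
    DerivVanishOn V n φ := by
  induction n generalizing φ with
  | zero => exact h
  | succ n ih =>
    refine fun u => ih fun y hy => ?_
    rw [dirDeriv_congr hV (ψ := fun _ => 0) h u hy]; simp

theorem succ (hV : IsOpen V) {n : ℕ} {φ : E → ℝ} (h : DerivVanishOn V n φ) :
    DerivVanishOn V (n + 1) φ := by
  induction n generalizing φ with
  | zero => exact of_zero hV h
  | succ n ih => exact fun u => ih (h u)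

theorem add (hV : IsOpen V) {n : ℕ} {φ ψ : E → ℝ} (hφs : ContDiffOn ℝ ∞ φ V)
    (hψs : ContDiffOn ℝ ∞ ψ V) (hφ : DerivVanishOn V n φ) (hψ : DerivVanishOn V n ψ) :
    DerivVanishOn V n fun y => φ y + ψ y := by
  induction n generalizing φ ψ with
  | zero => intro y hy; simp [hφ y hy, hψ y hy]
  | succ n ih =>
    refine fun u => (ih (hφs.dirDeriv hV u) (hψs.dirDeriv hV u) (hφ u) (hψ u)).congr hV ?_
    exact fun y hy => (dirDeriv_add (hφs.differentiableAt_of_isOpen hV hy)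
      (hψs.differentiableAt_of_isOpen hV hy) u).symm

theorem const_mul {n : ℕ} {φ : E → ℝ} (c : ℝ) (hφ : DerivVanishOn V n φ) :
    DerivVanishOn V n fun y => c * φ y := by
  induction n generalizing φ with
  | zero => intro y hy; simp [hφ y hy]
  | succ n ih =>
    intro u
    rw [dirDeriv_const_mul]
    exact ih (hφ u)

theorem sub (hV : IsOpen V) {n : ℕ} {φ ψ : E → ℝ} (hφs : ContDiffOn ℝ ∞ φ V)
    (hψs : ContDiffOn ℝ ∞ ψ V) (hφ : DerivVanishOn V n φ) (hψ : DerivVanishOn V n ψ) :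
    DerivVanishOn V n fun y => φ y - ψ y :=
  (hφ.add hV hφs (contDiffOn_const.mul hψs) (hψ.const_mul (-1))).congr hV fun y _ => by ring

theorem sum (hV : IsOpen V) {n : ℕ} {ι : Type*} {s : Finset ι} {φ : ι → E → ℝ}
    (hs : ∀ i ∈ s, ContDiffOn ℝ ∞ (φ i) V) (h : ∀ i ∈ s, DerivVanishOn V n (φ i)) :
    DerivVanishOn V n fun y => ∑ i ∈ s, φ i y := by
  classical
  induction s using Finset.induction_on with
  | empty => exact of_zero hV fun y _ => by simp
  | insert a s ha ih =>
    simp only [Finset.sum_insert ha]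
    exact add hV (hs a (by simp)) (ContDiffOn.sum fun i hi => hs i (by simp [hi])) (h a (by simp))
      (ih (fun i hi => hs i (by simp [hi])) fun i hi => h i (by simp [hi]))

/-- The degree of a product is the sum of the degrees. -/
theorem mul (hV : IsOpen V) {p q : ℕ} {φ ψ : E → ℝ} (hφs : ContDiffOn ℝ ∞ φ V)
    (hψs : ContDiffOn ℝ ∞ ψ V) (hφ : DerivVanishOn V (p + 1) φ) (hψ : DerivVanishOn V (q + 1) ψ) :
    DerivVanishOn V (p + q + 1) fun y => φ y * ψ y := by
  -- Order `p + 1` encodes degree at most `p`. By the Leibniz rule each derivative lowers the degree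
  -- of one factor; a factor of degree zero has zero derivative.
  induction hn : p + q generalizing p q φ ψ with
  | zero =>
    obtain ⟨rfl, rfl⟩ : p = 0 ∧ q = 0 := by omega
    intro u y hy
    rw [dirDeriv_mul (hφs.differentiableAt_of_isOpen hV hy)
      (hψs.differentiableAt_of_isOpen hV hy), hφ u y hy, hψ u y hy]; ring
  | succ n ih =>
    intro u
    have h1 : DerivVanishOn V (n + 1) fun y => dirDeriv u φ y * ψ y := by
      cases p with
      | zero => exact of_zero hV fun y hy => by rw [hφ u y hy, zero_mul]
      | succ p => exact ih (hφs.dirDeriv hV u) hψs (hφ u) hψ (by omega)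
    have h2 : DerivVanishOn V (n + 1) fun y => φ y * dirDeriv u ψ y := by
      cases q with
      | zero => exact of_zero hV fun y hy => by rw [hψ u y hy, mul_zero]
      | succ q => exact ih hφs (hψs.dirDeriv hV u) hφ (hψ u) (by omega)
    refine (add hV ((hφs.dirDeriv hV u).mul hψs) (hφs.mul (hψs.dirDeriv hV u)) h1 h2).congr hV ?_
    exact fun y hy => (dirDeriv_mul (hφs.differentiableAt_of_isOpen hV hy)
      (hψs.differentiableAt_of_isOpen hV hy) u).symm

theorem clm (l : E →L[ℝ] ℝ) : DerivVanishOn V 2 fun y => l y := fun u v y _ => by simp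

/-- Velocity polynomials stay so when they are differentiated in the position. -/
theorem dx {T : Set E} (hT : IsOpen T) (hV : IsOpen V) {n : ℕ} {Φ : E → E → ℝ}
    (hs : ContDiffOn ℝ ∞ (fun p : E × E => Φ p.1 p.2) (T ×ˢ V))
    (h : ∀ x ∈ T, DerivVanishOn V n (Φ x)) (u : E) :
    ∀ x ∈ T, DerivVanishOn V n (dx u Φ x) := by
  induction n generalizing Φ with
  | zero =>
    intro x hx y hy
    exact (dirDeriv_congr hT (ψ := fun _ => 0) (fun x' hx' => h x' hx' y hy) u hx).trans (by simp)
  | succ n ih =>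
    intro x hx v
    -- The velocity derivative is moved inside the position derivative, so that the induction
    -- hypothesis applies to `dy v Φ`.
    refine (ih (contDiffOn_dy (hT.prod hV) hs v) (fun x' hx' => h x' hx' v) x hx).congr hV ?_
    exact fun y hy => dx_dy_comm (hT.prod hV) hs u v ⟨hx, hy⟩

end DerivVanishOn

end Calculus

/-! ### A single Finsler metric in coordinates: Euler identities and raised covectors. -/

section LocalMetric

variable {E : Type*} [NormedAddCommGroup E] [NormedSpace ℝ E]
  {ι : Type*} [Fintype ι] [DecidableEq ι]

theorem dirDeriv_eq_sum (b : Module.Basis ι ℝ E) (u : E) (φ : E → ℝ) (y : E) :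
    dirDeriv u φ y = ∑ j, b.repr u j * dirDeriv (b j) φ y := by
  unfold dirDeriv
  conv_lhs => rw [← b.sum_repr u, map_sum]
  simp only [map_smul, smul_eq_mul]

/-- The coordinate functions of a basis. -/
def coordCLM (b : Module.Basis ι ℝ E) (j : ι) : E →L[ℝ] ℝ :=
  haveI := b.finiteDimensional_of_finite
  LinearMap.toContinuousLinearMap (b.coord j)

theorem coordCLM_apply (b : Module.Basis ι ℝ E) (j : ι) (y : E) : coordCLM b j y = b.repr y j := rfl

theorem coordCLM_basis (b : Module.Basis ι ℝ E) (i j : ι) :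
    coordCLM b j (b i) = if i = j then 1 else 0 := by
  simp [coordCLM_apply, Finsupp.single_apply]

theorem fundamentalTensor_apply (b : Module.Basis ι ℝ E) (F : E → E → ℝ) (x y : E) (i j : ι) :
    fundamentalTensor b F x y i j =
      1 / 2 * dirDeriv (b j) (dirDeriv (b i) fun y => F x y ^ 2) y := by
  simp only [fundamentalTensor, Matrix.of_apply, dy_eq_dirDeriv]
  simp

/-- Since `F F_{y^l} = (1/2) [F²]_{y^l}`, only `F²` enters the curvature, and `F²` is what splits
additively for a twisted product. Differentiability of `F` comes from `F = √(F²)` with `F² > 0`. -/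
theorem landsbergCurvature_eq (b : Module.Basis ι ℝ E) {F : E → E → ℝ} {x y : E}
    (h0 : ∀ y, 0 ≤ F x y) (hd : DifferentiableAt ℝ (fun y => F x y ^ 2) y) (hpos : 0 < F x y ^ 2)
    (i j k : ι) :
    landsbergCurvature b F i j k x y = -(1 / 4) * ∑ l, dirDeriv (b l) (fun y => F x y ^ 2) y *
      dirDeriv (b k) (dirDeriv (b j) (dirDeriv (b i) (sprayCoeff b F l x))) y := by
  have hF : DifferentiableAt ℝ (F x) y := by
    have : F x = fun y => Real.sqrt (F x y ^ 2) := by ext y; rw [Real.sqrt_sq (h0 y)]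
    rw [this]
    exact hd.sqrt hpos.ne'
  have key (l : ι) : dirDeriv (b l) (fun y => F x y ^ 2) y =
      2 * (F x y * dirDeriv (b l) (F x) y) := by
    simp only [pow_two]
    rw [dirDeriv_mul hF hF]; ring
  unfold landsbergCurvature
  rw [Finset.mul_sum, Finset.mul_sum]
  refine Finset.sum_congr rfl fun l _ => ?_
  rw [key, dy_eq_dirDeriv]
  change -(1 / 2) * (_ * dirDeriv (b k) (dirDeriv (b j) (dirDeriv (b i) (sprayCoeff b F l x))) y) = _
  ring

theorem contDiffOn_matrix_det {𝓔 : Type*} [NormedAddCommGroup 𝓔] [NormedSpace ℝ 𝓔] {U : Set 𝓔}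
    {A : 𝓔 → Matrix ι ι ℝ} (h : ∀ i j, ContDiffOn ℝ ∞ (fun p => A p i j) U) :
    ContDiffOn ℝ ∞ (fun p => (A p).det) U := by
  simp only [Matrix.det_apply']
  exact ContDiffOn.sum fun σ _ => contDiffOn_const.mul (contDiffOn_prod fun i _ => h _ _)

/-- Cramer's rule: each entry of the inverse is a quotient of determinants of smooth matrices. -/
theorem contDiffOn_matrix_inv {𝓔 : Type*} [NormedAddCommGroup 𝓔] [NormedSpace ℝ 𝓔] {U : Set 𝓔}
    {A : 𝓔 → Matrix ι ι ℝ} (h : ∀ i j, ContDiffOn ℝ ∞ (fun p => A p i j) U)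
    (hA : ∀ p ∈ U, (A p).det ≠ 0) (i j : ι) : ContDiffOn ℝ ∞ (fun p => (A p)⁻¹ i j) U := by
  simp only [Matrix.inv_def, Matrix.smul_apply, smul_eq_mul, Ring.inverse_eq_inv',
    Matrix.adjugate_apply]
  refine ((contDiffOn_matrix_det h).inv hA).mul (contDiffOn_matrix_det fun k l => ?_)
  by_cases hk : k = j
  · subst hk; simp only [Matrix.updateRow_self]; exact contDiffOn_const
  · simp only [Matrix.updateRow_ne hk]; exact h k l

/-- `F` is a Finsler metric on the open subset `T` of the coordinate space. -/
structure IsFinslerOn (b : Module.Basis ι ℝ E) (T : Set E) (F : E → E → ℝ) : Prop where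
  isOpen : IsOpen T
  nonneg : ∀ x ∈ T, ∀ y, 0 ≤ F x y
  smooth : ContDiffOn ℝ ∞ (fun p : E × E => F p.1 p.2) (T ×ˢ {0}ᶜ)
  homogeneous : ∀ x ∈ T, ∀ y, ∀ c : ℝ, 0 < c → F x (c • y) = c * F x y
  posDef : ∀ x ∈ T, ∀ y, y ≠ 0 → (fundamentalTensor b F x y).PosDef

/-- The covector `c` with its index raised by the fundamental tensor. -/
def raise (b : Module.Basis ι ℝ E) (F : E → E → ℝ) (c : ι → ℝ) (x : E) (l : ι) (y : E) : ℝ :=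
  ∑ p, (fundamentalTensor b F x y)⁻¹ l p * c p

/-- `[F²]_{x^q y^p} y^q - [F²]_{x^p}`. -/
def sprayCovector (b : Module.Basis ι ℝ E) (F : E → E → ℝ) (p : ι) (x y : E) : ℝ :=
  (∑ q, dy (b p) (dx (b q) (fun x y => F x y ^ 2)) x y * b.repr y q)
    - dx (b p) (fun x y => F x y ^ 2) x y

theorem sprayCoeff_eq (b : Module.Basis ι ℝ E) (F : E → E → ℝ) (i : ι) (x y : E) :
    sprayCoeff b F i x y = 1 / 4 * ∑ p, (fundamentalTensor b F x y)⁻¹ i p * sprayCovector b F p x y :=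
  rfl

namespace IsFinslerOn

variable {b : Module.Basis ι ℝ E} {T : Set E} {F : E → E → ℝ} {x y : E}

theorem contDiffOn_sq (hF : IsFinslerOn b T F) :
    ContDiffOn ℝ ∞ (fun p : E × E => F p.1 p.2 ^ 2) (T ×ˢ {0}ᶜ) :=
  hF.smooth.pow 2

theorem isOpen_prod (hF : IsFinslerOn b T F) : IsOpen (T ×ˢ ({0}ᶜ : Set E)) :=
  hF.isOpen.prod isOpen_compl_singleton

theorem contDiffOn_sq_slice (hF : IsFinslerOn b T F) (hx : x ∈ T) :
    ContDiffOn ℝ ∞ (fun y => F x y ^ 2) {0}ᶜ :=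
  contDiffOn_slice (Φ := fun x y => F x y ^ 2) hF.contDiffOn_sq hx

theorem contDiffOn_fundamentalTensor (hF : IsFinslerOn b T F) (i j : ι) :
    ContDiffOn ℝ ∞ (fun p : E × E => fundamentalTensor b F p.1 p.2 i j) (T ×ˢ {0}ᶜ) := by
  simp only [fundamentalTensor_apply]
  exact contDiffOn_const.mul (contDiffOn_dy hF.isOpen_prod
    (contDiffOn_dy (Φ := fun x y => F x y ^ 2) hF.isOpen_prod hF.contDiffOn_sq (b i)) (b j))

theorem det_ne_zero (hF : IsFinslerOn b T F) (hx : x ∈ T) (hy : y ≠ 0) :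
    (fundamentalTensor b F x y).det ≠ 0 :=
  (hF.posDef x hx y hy).det_pos.ne'

theorem contDiffOn_inv (hF : IsFinslerOn b T F) (i j : ι) :
    ContDiffOn ℝ ∞ (fun p : E × E => (fundamentalTensor b F p.1 p.2)⁻¹ i j) (T ×ˢ {0}ᶜ) :=
  contDiffOn_matrix_inv hF.contDiffOn_fundamentalTensor
    (fun _ hp => hF.det_ne_zero hp.1 hp.2) i j

theorem symm (hF : IsFinslerOn b T F) (hx : x ∈ T) (hy : y ≠ 0) (i j : ι) :
    fundamentalTensor b F x y i j = fundamentalTensor b F x y j i := by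
  simpa using ((hF.posDef x hx y hy).1.apply i j).symm

theorem inv_symm (hF : IsFinslerOn b T F) (hx : x ∈ T) (hy : y ≠ 0) (i j : ι) :
    (fundamentalTensor b F x y)⁻¹ i j = (fundamentalTensor b F x y)⁻¹ j i := by
  simpa using ((hF.posDef x hx y hy).1.inv.apply i j).symm

theorem sum_mul_inv (hF : IsFinslerOn b T F) (hx : x ∈ T) (hy : y ≠ 0) (i j : ι) :
    ∑ k, fundamentalTensor b F x y i k * (fundamentalTensor b F x y)⁻¹ k j =
      if i = j then 1 else 0 := by
  rw [← Matrix.mul_apply, Matrix.mul_nonsing_inv _ (hF.det_ne_zero hx hy).isUnit,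
    Matrix.one_apply]

theorem sum_inv_mul (hF : IsFinslerOn b T F) (hx : x ∈ T) (hy : y ≠ 0) (i j : ι) :
    ∑ k, (fundamentalTensor b F x y)⁻¹ i k * fundamentalTensor b F x y k j =
      if i = j then 1 else 0 := by
  rw [← Matrix.mul_apply, Matrix.nonsing_inv_mul _ (hF.det_ne_zero hx hy).isUnit,
    Matrix.one_apply]

theorem map_zero (hF : IsFinslerOn b T F) (hx : x ∈ T) : F x 0 = 0 := by
  have := hF.homogeneous x hx 0 2 two_pos
  rw [smul_zero] at this
  linarith

/-- Euler's identity `y^j [F²]_{y^j} = 2F²`. -/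
theorem euler (hF : IsFinslerOn b T F) (hx : x ∈ T) (hy : y ≠ 0) :
    ∑ j, b.repr y j * dirDeriv (b j) (fun y => F x y ^ 2) y = 2 * F x y ^ 2 := by
  rw [← dirDeriv_eq_sum]
  have hd := (hF.contDiffOn_sq_slice hx).differentiableAt_of_isOpen isOpen_compl_singleton hy
  -- The derivative of `F(x, cy)²` at `c = 1` is computed by the chain rule in `h2` and from the
  -- homogeneous form `c² F²` in `h3`; the two functions agree for `c > 0`, hence near `1`.
  have h1 : HasDerivAt (fun c : ℝ => c • y) y 1 := by
    simpa using (hasDerivAt_id (1 : ℝ)).smul_const y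
  have h2 : HasDerivAt (fun c : ℝ => F x (c • y) ^ 2) (dirDeriv y (fun y => F x y ^ 2) y) 1 :=
    HasFDerivAt.comp_hasDerivAt (l := fun y => F x y ^ 2) (f := fun c : ℝ => c • y) 1
      (by simpa using hd.hasFDerivAt) h1
  have h3 : HasDerivAt (fun c : ℝ => c ^ 2 * F x y ^ 2) (2 * F x y ^ 2) 1 := by
    simpa using ((hasDerivAt_id (1 : ℝ)).pow 2).mul_const (F x y ^ 2)
  refine h2.unique (h3.congr_of_eventuallyEq ?_)
  filter_upwards [lt_mem_nhds one_pos] with c hc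
  rw [hF.homogeneous x hx y c hc]; ring

/-- `y_i = g_{ij} y^j`, where `y_i = [F²]_{y^i} / 2`. -/
theorem sum_fundamentalTensor_mul (hF : IsFinslerOn b T F) (hx : x ∈ T) (hy : y ≠ 0) (i : ι) :
    ∑ j, fundamentalTensor b F x y i j * b.repr y j =
      1 / 2 * dirDeriv (b i) (fun y => F x y ^ 2) y := by
  have hS := hF.contDiffOn_sq_slice hx
  have hV : IsOpen ({0}ᶜ : Set E) := isOpen_compl_singleton
  -- Differentiating Euler's identity gives `[F²]_{y^i} + 2 g_{ij} y^j = 2 [F²]_{y^i}`.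
  have h := dirDeriv_congr hV (fun y hy => hF.euler hx hy) (b i) (show y ∈ ({0}ᶜ : Set E) from hy)
  simp only [dirDeriv_const_mul, ← coordCLM_apply] at h
  rw [dirDeriv_sum (fun j _ => ((coordCLM b j).differentiableAt).fun_mul
    ((hS.dirDeriv hV _).differentiableAt_of_isOpen hV hy))] at h
  have h' (j : ι) : dirDeriv (b i) (fun y => coordCLM b j y *
      dirDeriv (b j) (fun y => F x y ^ 2) y) y = (if i = j then 1 else 0) *
        dirDeriv (b j) (fun y => F x y ^ 2) y +
      2 * (fundamentalTensor b F x y i j * b.repr y j) := by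
    rw [dirDeriv_mul (coordCLM b j).differentiableAt
      ((hS.dirDeriv hV _).differentiableAt_of_isOpen hV hy), dirDeriv_clm, coordCLM_basis,
      hF.symm hx hy i j, fundamentalTensor_apply, coordCLM_apply]
    ring
  simp only [h', Finset.sum_add_distrib, ← Finset.mul_sum, ite_mul, one_mul, zero_mul,
    Finset.sum_ite_eq, Finset.mem_univ, if_true] at h
  linarith

/-- `F² = g_{ij} y^i y^j`. -/
theorem sq_eq (hF : IsFinslerOn b T F) (hx : x ∈ T) (hy : y ≠ 0) :
    F x y ^ 2 = ∑ i, ∑ j, fundamentalTensor b F x y i j * b.repr y i * b.repr y j := by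
  have h := hF.euler hx hy
  have h' (i : ι) : ∑ j, fundamentalTensor b F x y i j * b.repr y i * b.repr y j =
      1 / 2 * (b.repr y i * dirDeriv (b i) (fun y => F x y ^ 2) y) := by
    rw [mul_left_comm, ← hF.sum_fundamentalTensor_mul hx hy i, Finset.mul_sum]
    exact Finset.sum_congr rfl fun j _ => by ring
  simp only [h', ← Finset.mul_sum, h]
  ring

theorem sq_pos (hF : IsFinslerOn b T F) (hx : x ∈ T) (hy : y ≠ 0) : 0 < F x y ^ 2 := by
  rw [hF.sq_eq hx hy]
  have h0 : (fun i => b.repr y i) ≠ 0 := fun h => hy (b.repr.map_eq_zero_iff.1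
    (Finsupp.ext fun i => congrFun h i))
  have := (hF.posDef x hx y hy).dotProduct_mulVec_pos h0
  simp only [dotProduct, Matrix.mulVec, star_trivial, Finset.mul_sum] at this
  refine this.trans_eq (Finset.sum_congr rfl fun i _ => Finset.sum_congr rfl fun j _ => by ring)

/-- `g^{ai} y_i = y^a`. -/
theorem sum_inv_mul_dirDeriv (hF : IsFinslerOn b T F) (hx : x ∈ T) (hy : y ≠ 0) (a : ι) :
    ∑ i, (fundamentalTensor b F x y)⁻¹ a i * dirDeriv (b i) (fun y => F x y ^ 2) y =
      2 * b.repr y a := by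
  have h (i : ι) : dirDeriv (b i) (fun y => F x y ^ 2) y =
      2 * ∑ j, fundamentalTensor b F x y i j * b.repr y j := by
    rw [hF.sum_fundamentalTensor_mul hx hy i]; ring
  simp only [h, Finset.mul_sum]
  rw [Finset.sum_comm]
  have h' (j : ι) : ∑ i, (fundamentalTensor b F x y)⁻¹ a i *
      (2 * (fundamentalTensor b F x y i j * b.repr y j)) =
        (if a = j then 1 else 0) * (2 * b.repr y j) := by
    rw [← hF.sum_inv_mul hx hy a j, Finset.sum_mul]
    exact Finset.sum_congr rfl fun i _ => by ring
  simp [h']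

theorem contDiffOn_inv_slice (hF : IsFinslerOn b T F) (hx : x ∈ T) (i j : ι) :
    ContDiffOn ℝ ∞ (fun y => (fundamentalTensor b F x y)⁻¹ i j) {0}ᶜ :=
  contDiffOn_slice (Φ := fun x y => (fundamentalTensor b F x y)⁻¹ i j) (hF.contDiffOn_inv i j) hx

theorem contDiffOn_fundamentalTensor_slice (hF : IsFinslerOn b T F) (hx : x ∈ T) (i j : ι) :
    ContDiffOn ℝ ∞ (fun y => fundamentalTensor b F x y i j) {0}ᶜ :=
  contDiffOn_slice (Φ := fun x y => fundamentalTensor b F x y i j)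
    (hF.contDiffOn_fundamentalTensor i j) hx

theorem contDiffOn_dx_slice (hF : IsFinslerOn b T F) (hx : x ∈ T) (u : E) :
    ContDiffOn ℝ ∞ (dx u (fun x y => F x y ^ 2) x) {0}ᶜ :=
  contDiffOn_slice (Φ := dx u (fun x y => F x y ^ 2))
    (contDiffOn_dx (Φ := fun x y => F x y ^ 2) hF.isOpen_prod hF.contDiffOn_sq u) hx

theorem contDiffOn_sprayCovector (hF : IsFinslerOn b T F) (hx : x ∈ T) (p : ι) :
    ContDiffOn ℝ ∞ (sprayCovector b F p x) {0}ᶜ :=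
  (ContDiffOn.sum fun q _ => ((hF.contDiffOn_dx_slice hx (b q)).dirDeriv isOpen_compl_singleton
    (b p)).mul (coordCLM b q).contDiff.contDiffOn).sub (hF.contDiffOn_dx_slice hx (b p))

theorem contDiffOn_sprayCoeff (hF : IsFinslerOn b T F) (hx : x ∈ T) (i : ι) :
    ContDiffOn ℝ ∞ (sprayCoeff b F i x) {0}ᶜ :=
  contDiffOn_const.mul (ContDiffOn.sum fun p _ => (hF.contDiffOn_inv_slice hx i p).mul
    (hF.contDiffOn_sprayCovector hx p))

theorem contDiffOn_raise (hF : IsFinslerOn b T F) (hx : x ∈ T) (c : ι → ℝ) (l : ι) :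
    ContDiffOn ℝ ∞ (raise b F c x l) {0}ᶜ :=
  ContDiffOn.sum fun p _ => (hF.contDiffOn_inv_slice hx l p).mul contDiffOn_const

/-- Raising an index of a covector and lowering it again. -/
theorem sum_mul_raise (hF : IsFinslerOn b T F) (hx : x ∈ T) (hy : y ≠ 0) (c : ι → ℝ) (i : ι) :
    ∑ l, fundamentalTensor b F x y i l * raise b F c x l y = c i := by
  simp only [raise, Finset.mul_sum]
  rw [Finset.sum_comm]
  simp only [← mul_assoc, ← Finset.sum_mul, hF.sum_mul_inv hx hy]
  simp

/-- Follows from `g^{lp} [F²]_{y^l} = 2 y^p`. The right side is linear in `y`, which makes repeated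
differentiation of this identity fruitful. -/
theorem sum_dirDeriv_mul_raise (hF : IsFinslerOn b T F) (hx : x ∈ T) (hy : y ≠ 0) (c : ι → ℝ) :
    ∑ l, dirDeriv (b l) (fun y => F x y ^ 2) y * raise b F c x l y =
      2 * ∑ p, c p * b.repr y p := by
  simp only [raise, Finset.mul_sum]
  rw [Finset.sum_comm]
  refine Finset.sum_congr rfl fun p _ => ?_
  rw [mul_left_comm, ← hF.sum_inv_mul_dirDeriv hx hy p, Finset.mul_sum]
  exact Finset.sum_congr rfl fun l _ => by rw [hF.inv_symm hx hy l p]; ring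

/-- In the derivative of `sum_dirDeriv_mul_raise`, the term `[F²]_{y^l y^i} K^l = 2 g_{il} K^l = 2
c_i` cancels the derivative of the right side. -/
theorem sum_dirDeriv_mul_dirDeriv_raise (hF : IsFinslerOn b T F) (hx : x ∈ T) (hy : y ≠ 0)
    (c : ι → ℝ) (i : ι) :
    ∑ l, dirDeriv (b l) (fun y => F x y ^ 2) y * dirDeriv (b i) (raise b F c x l) y = 0 := by
  have hV : IsOpen ({0}ᶜ : Set E) := isOpen_compl_singleton
  have hK (l : ι) := (hF.contDiffOn_raise hx c l).differentiableAt_of_isOpen hV hy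
  have hS (l : ι) := ((hF.contDiffOn_sq_slice hx).dirDeriv hV (b l)).differentiableAt_of_isOpen hV hy
  have h := dirDeriv_congr hV (fun y hy => hF.sum_dirDeriv_mul_raise hx hy c) (b i)
    (show y ∈ ({0}ᶜ : Set E) from hy)
  simp only [dirDeriv_const_mul, ← coordCLM_apply] at h
  rw [dirDeriv_sum (fun l _ => (hS l).fun_mul (hK l)),
    dirDeriv_sum (fun j _ => ((coordCLM b j).differentiableAt).const_mul (c j))] at h
  simp only [dirDeriv_mul (hS _) (hK _), dirDeriv_const_mul, dirDeriv_clm, coordCLM_basis,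
    Finset.sum_add_distrib] at h
  have h2 : ∑ l, dirDeriv (b i) (dirDeriv (b l) fun y => F x y ^ 2) y * raise b F c x l y =
      2 * c i := by
    rw [← hF.sum_mul_raise hx hy c i, Finset.mul_sum]
    refine Finset.sum_congr rfl fun l _ => ?_
    rw [hF.symm hx hy i l, fundamentalTensor_apply]; ring
  rw [h2] at h
  simpa using h

/-- A further derivative of the vanishing sum trades a second derivative of the raised covector for
a first derivative lowered by `g`. -/
theorem sum_dirDeriv_mul_dirDeriv_dirDeriv_raise (hF : IsFinslerOn b T F) (hx : x ∈ T)
    (hy : y ≠ 0) (c : ι → ℝ) (i j : ι) :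
    ∑ l, dirDeriv (b l) (fun y => F x y ^ 2) y *
      dirDeriv (b j) (dirDeriv (b i) (raise b F c x l)) y =
    -2 * ∑ l, fundamentalTensor b F x y j l * dirDeriv (b i) (raise b F c x l) y := by
  have hV : IsOpen ({0}ᶜ : Set E) := isOpen_compl_singleton
  have hK (l : ι) :=
    ((hF.contDiffOn_raise hx c l).dirDeriv hV (b i)).differentiableAt_of_isOpen hV hy
  have hS (l : ι) := ((hF.contDiffOn_sq_slice hx).dirDeriv hV (b l)).differentiableAt_of_isOpen hV hy
  have h := dirDeriv_congr hV (ψ := fun _ => 0)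
    (fun y hy => hF.sum_dirDeriv_mul_dirDeriv_raise hx hy c i) (b j)
    (show y ∈ ({0}ᶜ : Set E) from hy)
  rw [dirDeriv_sum (fun l _ => (hS l).fun_mul (hK l))] at h
  simp only [dirDeriv_mul (hS _) (hK _), dirDeriv_const, Finset.sum_add_distrib] at h
  have h2 : ∑ l, dirDeriv (b j) (dirDeriv (b l) fun y => F x y ^ 2) y *
      dirDeriv (b i) (raise b F c x l) y =
        2 * ∑ l, fundamentalTensor b F x y j l * dirDeriv (b i) (raise b F c x l) y := by
    rw [Finset.mul_sum]
    refine Finset.sum_congr rfl fun l _ => ?_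
    rw [hF.symm hx hy j l, fundamentalTensor_apply]; ring
  linarith

/-- Differentiate `g_{al} K^l = c_a`, whose right side does not depend on the velocity: `2 C_{ali}
K^l + g_{al} ∂_i K^l = 0`. -/
theorem cartanTorsionRaised_contract (hF : IsFinslerOn b T F) (hx : x ∈ T) (hy : y ≠ 0)
    (c : ι → ℝ) (a i : ι) :
    ∑ p, cartanTorsionRaised b F p a i x y * c p =
      -(1 / 2) * ∑ l, fundamentalTensor b F x y a l * dirDeriv (b i) (raise b F c x l) y := by
  have hV : IsOpen ({0}ᶜ : Set E) := isOpen_compl_singleton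
  have hK (l : ι) := (hF.contDiffOn_raise hx c l).differentiableAt_of_isOpen hV hy
  have hg (l : ι) :=
    (hF.contDiffOn_fundamentalTensor_slice hx a l).differentiableAt_of_isOpen hV hy
  have h := dirDeriv_congr hV (ψ := fun _ => c a) (fun y hy => hF.sum_mul_raise hx hy c a) (b i)
    (show y ∈ ({0}ᶜ : Set E) from hy)
  rw [dirDeriv_sum (fun l _ => (hg l).fun_mul (hK l))] at h
  simp only [dirDeriv_mul (hg _) (hK _), dirDeriv_const, Finset.sum_add_distrib] at h
  have h2 : ∑ l, dirDeriv (b i) (fun y => fundamentalTensor b F x y a l) y * raise b F c x l y =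
      2 * ∑ p, cartanTorsionRaised b F p a i x y * c p := by
    simp only [cartanTorsionRaised, raise, Finset.mul_sum, Finset.sum_mul]
    rw [Finset.sum_comm]
    refine Finset.sum_congr rfl fun p _ => Finset.sum_congr rfl fun k _ => ?_
    rw [cartanTorsion, dy_eq_dirDeriv, hF.inv_symm hx hy k p,
      dirDeriv_congr hV (fun y hy => hF.symm hx hy a k) (b i) (show y ∈ ({0}ᶜ : Set E) from hy)]
    ring
  linarith

theorem eq_zero_of_sum_fundamentalTensor_mul (hF : IsFinslerOn b T F) (hx : x ∈ T) (hy : y ≠ 0)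
    {v : ι → ℝ} (h : ∀ a, ∑ l, fundamentalTensor b F x y a l * v l = 0) : v = 0 :=
  Matrix.eq_zero_of_mulVec_eq_zero (hF.det_ne_zero hx hy) (funext h)

/-- Invertibility of `g` removes the lowering in `cartanTorsionRaised_contract`: the raised covector
is stationary in the velocity where its contraction with the torsion vanishes. -/
theorem dirDeriv_raise_eq_zero (hF : IsFinslerOn b T F) (hx : x ∈ T) (hy : y ≠ 0) {c : ι → ℝ}
    (h : ∀ i j, ∑ p, cartanTorsionRaised b F p i j x y * c p = 0) (i l : ι) :
    dirDeriv (b i) (raise b F c x l) y = 0 := by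
  refine congrFun (hF.eq_zero_of_sum_fundamentalTensor_mul hx hy
    (v := fun l => dirDeriv (b i) (raise b F c x l) y) fun a => ?_) l
  have := hF.cartanTorsionRaised_contract hx hy c a i
  rw [h] at this
  linarith

/-- The contraction of the Cartan torsion with a covector is determined by the second derivatives
of that covector with its index raised. -/
theorem cartanTorsionRaised_contract_eq (hF : IsFinslerOn b T F) (hx : x ∈ T) (hy : y ≠ 0)
    (c : ι → ℝ) (i j : ι) :
    ∑ l, dirDeriv (b l) (fun y => F x y ^ 2) y *
      dirDeriv (b j) (dirDeriv (b i) (raise b F c x l)) y =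
    4 * ∑ p, cartanTorsionRaised b F p j i x y * c p := by
  rw [hF.sum_dirDeriv_mul_dirDeriv_dirDeriv_raise hx hy, hF.cartanTorsionRaised_contract hx hy]
  ring

end IsFinslerOn
end LocalMetric

/-! ### Spray and Landsberg curvature of a twisted product in coordinates. -/

section LocalProduct

variable {E₁ : Type*} [NormedAddCommGroup E₁] [NormedSpace ℝ E₁]
  {E₂ : Type*} [NormedAddCommGroup E₂] [NormedSpace ℝ E₂]
  {ι₁ : Type*} [Fintype ι₁] [DecidableEq ι₁] {ι₂ : Type*} [Fintype ι₂] [DecidableEq ι₂]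

theorem dx_zero_dir {E : Type*} [NormedAddCommGroup E] [NormedSpace ℝ E] (Φ : E → E → ℝ) :
    dx (0 : E) Φ = fun _ _ => 0 := by
  ext; simp [dx]

theorem basis_prod_inl (b₁ : Module.Basis ι₁ ℝ E₁) (b₂ : Module.Basis ι₂ ℝ E₂) (i : ι₁) :
    b₁.prod b₂ (Sum.inl i) = (b₁ i, 0) := by
  ext <;> simp

theorem basis_prod_inr (b₁ : Module.Basis ι₁ ℝ E₁) (b₂ : Module.Basis ι₂ ℝ E₂) (i : ι₂) :
    b₁.prod b₂ (Sum.inr i) = (0, b₂ i) := by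
  ext <;> simp

theorem dirDeriv_add_prod {φ : E₁ → ℝ} {ψ : E₂ → ℝ} {w : E₁ × E₂} (hφ : DifferentiableAt ℝ φ w.1)
    (hψ : DifferentiableAt ℝ ψ w.2) (u : E₁ × E₂) :
    dirDeriv u (fun w : E₁ × E₂ => φ w.1 + ψ w.2) w = dirDeriv u.1 φ w.1 + dirDeriv u.2 ψ w.2 := by
  have h1 : HasFDerivAt (fun w : E₁ × E₂ => φ w.1) _ w := hφ.hasFDerivAt.comp w hasFDerivAt_fst
  have h2 : HasFDerivAt (fun w : E₁ × E₂ => ψ w.2) _ w := hψ.hasFDerivAt.comp w hasFDerivAt_snd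
  unfold dirDeriv
  rw [(h1.fun_add h2).fderiv]
  simp

theorem dirDeriv_mul_prod {φ : E₁ → ℝ} {ψ : E₂ → ℝ} {w : E₁ × E₂} (hφ : DifferentiableAt ℝ φ w.1)
    (hψ : DifferentiableAt ℝ ψ w.2) (u : E₁ × E₂) :
    dirDeriv u (fun w : E₁ × E₂ => φ w.1 * ψ w.2) w =
      dirDeriv u.1 φ w.1 * ψ w.2 + φ w.1 * dirDeriv u.2 ψ w.2 := by
  have h1 : HasFDerivAt (fun w : E₁ × E₂ => φ w.1) _ w := hφ.hasFDerivAt.comp w hasFDerivAt_fst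
  have h2 : HasFDerivAt (fun w : E₁ × E₂ => ψ w.2) _ w := hψ.hasFDerivAt.comp w hasFDerivAt_snd
  unfold dirDeriv
  rw [(h1.fun_mul h2).fderiv]
  simp
  ring

/-- The action on a function of the first velocity of the derivative in the direction `s`. -/
def derivLeft (b₁ : Module.Basis ι₁ ℝ E₁) : ι₁ ⊕ ι₂ → (E₁ → ℝ) → E₁ → ℝ
  | Sum.inl i, φ => dirDeriv (b₁ i) φ
  | Sum.inr _, φ => φ

/-- The action on a function of the second velocity of the derivative in the direction `s`. -/
def derivRight (b₂ : Module.Basis ι₂ ℝ E₂) : ι₁ ⊕ ι₂ → (E₂ → ℝ) → E₂ → ℝ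
  | Sum.inl _, φ => φ
  | Sum.inr i, φ => dirDeriv (b₂ i) φ

theorem contDiffOn_derivLeft (b₁ : Module.Basis ι₁ ℝ E₁) {V : Set E₁} (hV : IsOpen V) {φ : E₁ → ℝ}
    (h : ContDiffOn ℝ ∞ φ V) (s : ι₁ ⊕ ι₂) : ContDiffOn ℝ ∞ (derivLeft b₁ s φ) V := by
  cases s
  · exact h.dirDeriv hV _
  · exact h

theorem contDiffOn_derivRight (b₂ : Module.Basis ι₂ ℝ E₂) {V : Set E₂} (hV : IsOpen V) {φ : E₂ → ℝ}
    (h : ContDiffOn ℝ ∞ φ V) (s : ι₁ ⊕ ι₂) : ContDiffOn ℝ ∞ (derivRight b₂ s φ) V := by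
  cases s
  · exact h
  · exact h.dirDeriv hV _

section Tensor

variable (b₁ : Module.Basis ι₁ ℝ E₁) (b₂ : Module.Basis ι₂ ℝ E₂) {V₁ : Set E₁} {V₂ : Set E₂}

theorem dirDeriv_tensor {φ : E₁ → ℝ} {ψ : E₂ → ℝ} {w : E₁ × E₂} (hφ : DifferentiableAt ℝ φ w.1)
    (hψ : DifferentiableAt ℝ ψ w.2) (s : ι₁ ⊕ ι₂) :
    dirDeriv (b₁.prod b₂ s) (fun w : E₁ × E₂ => φ w.1 * ψ w.2) w =
      derivLeft b₁ s φ w.1 * derivRight b₂ s ψ w.2 := by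
  rw [dirDeriv_mul_prod hφ hψ]
  cases s
  · simp [derivLeft, derivRight]
  · simp [derivLeft, derivRight]

theorem dirDeriv_tensor_add (hV₁ : IsOpen V₁) (hV₂ : IsOpen V₂) {φ φ' : E₁ → ℝ} {ψ ψ' : E₂ → ℝ}
    (hφ : ContDiffOn ℝ ∞ φ V₁) (hφ' : ContDiffOn ℝ ∞ φ' V₁) (hψ : ContDiffOn ℝ ∞ ψ V₂)
    (hψ' : ContDiffOn ℝ ∞ ψ' V₂) {G : E₁ × E₂ → ℝ}
    (hG : Set.EqOn G (fun w => φ w.1 * ψ w.2 + φ' w.1 * ψ' w.2) (V₁ ×ˢ V₂)) (s : ι₁ ⊕ ι₂) :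
    Set.EqOn (dirDeriv (b₁.prod b₂ s) G)
      (fun w => derivLeft b₁ s φ w.1 * derivRight b₂ s ψ w.2 +
        derivLeft b₁ s φ' w.1 * derivRight b₂ s ψ' w.2) (V₁ ×ˢ V₂) := by
  intro w hw
  have h1 := hφ.differentiableAt_of_isOpen hV₁ hw.1
  have h2 := hφ'.differentiableAt_of_isOpen hV₁ hw.1
  have h3 := hψ.differentiableAt_of_isOpen hV₂ hw.2
  have h4 := hψ'.differentiableAt_of_isOpen hV₂ hw.2
  have h5 : DifferentiableAt ℝ (fun w : E₁ × E₂ => φ w.1 * ψ w.2) w :=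
    DifferentiableAt.fun_mul (h1.comp w differentiableAt_fst) (h3.comp w differentiableAt_snd)
  have h6 : DifferentiableAt ℝ (fun w : E₁ × E₂ => φ' w.1 * ψ' w.2) w :=
    DifferentiableAt.fun_mul (h2.comp w differentiableAt_fst) (h4.comp w differentiableAt_snd)
  rw [dirDeriv_congr (hV₁.prod hV₂) hG _ hw, dirDeriv_add h5 h6]
  exact congrArg₂ _ (dirDeriv_tensor b₁ b₂ h1 h3 s) (dirDeriv_tensor b₁ b₂ h2 h4 s)

/-- A basis vector of the product differentiates just one factor of `φ(y) ψ(v)`, so sums of two such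
products keep their shape. One formula thus covers all choices of the three indices. -/
theorem dirDeriv_dirDeriv_dirDeriv_tensor_add (hV₁ : IsOpen V₁) (hV₂ : IsOpen V₂)
    {φ φ' : E₁ → ℝ} {ψ ψ' : E₂ → ℝ}
    (hφ : ContDiffOn ℝ ∞ φ V₁) (hφ' : ContDiffOn ℝ ∞ φ' V₁) (hψ : ContDiffOn ℝ ∞ ψ V₂)
    (hψ' : ContDiffOn ℝ ∞ ψ' V₂) {G : E₁ × E₂ → ℝ}
    (hG : Set.EqOn G (fun w => φ w.1 * ψ w.2 + φ' w.1 * ψ' w.2) (V₁ ×ˢ V₂)) (i j k : ι₁ ⊕ ι₂)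
    {w : E₁ × E₂} (hw : w ∈ V₁ ×ˢ V₂) :
    dirDeriv (b₁.prod b₂ k) (dirDeriv (b₁.prod b₂ j) (dirDeriv (b₁.prod b₂ i) G)) w =
      derivLeft b₁ k (derivLeft b₁ j (derivLeft b₁ i φ)) w.1 *
        derivRight b₂ k (derivRight b₂ j (derivRight b₂ i ψ)) w.2 +
      derivLeft b₁ k (derivLeft b₁ j (derivLeft b₁ i φ')) w.1 *
        derivRight b₂ k (derivRight b₂ j (derivRight b₂ i ψ')) w.2 := by
  have l {φ : E₁ → ℝ} (h : ContDiffOn ℝ ∞ φ V₁) (s : ι₁ ⊕ ι₂) := contDiffOn_derivLeft b₁ hV₁ h s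
  have r {φ : E₂ → ℝ} (h : ContDiffOn ℝ ∞ φ V₂) (s : ι₁ ⊕ ι₂) := contDiffOn_derivRight b₂ hV₂ h s
  have h1 := dirDeriv_tensor_add b₁ b₂ hV₁ hV₂ hφ hφ' hψ hψ' hG i
  have h2 := dirDeriv_tensor_add b₁ b₂ hV₁ hV₂ (l hφ i) (l hφ' i) (r hψ i) (r hψ' i) h1 j
  exact dirDeriv_tensor_add b₁ b₂ hV₁ hV₂ (l (l hφ i) j) (l (l hφ' i) j) (r (r hψ i) j)
    (r (r hψ' i) j) h2 k hw

end Tensor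

/-- `F` is the twisted product `√(F₁² + h F₂²)` over the open subset `T₁ × T₂` of the coordinate
space. -/
structure IsTwistedProductOn (b₁ : Module.Basis ι₁ ℝ E₁) (b₂ : Module.Basis ι₂ ℝ E₂) (T₁ : Set E₁)
    (T₂ : Set E₂) (F₁ : E₁ → E₁ → ℝ) (F₂ : E₂ → E₂ → ℝ) (h : E₁ × E₂ → ℝ)
    (F : E₁ × E₂ → E₁ × E₂ → ℝ) : Prop where
  left : IsFinslerOn b₁ T₁ F₁
  right : IsFinslerOn b₂ T₂ F₂
  differentiableAt : ∀ z ∈ T₁ ×ˢ T₂, DifferentiableAt ℝ h z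
  pos : ∀ z ∈ T₁ ×ˢ T₂, 0 < h z
  nonneg : ∀ z ∈ T₁ ×ˢ T₂, ∀ w, 0 ≤ F z w
  sq : ∀ z ∈ T₁ ×ˢ T₂, ∀ w, F z w ^ 2 = F₁ z.1 w.1 ^ 2 + h z * F₂ z.2 w.2 ^ 2

/-- The pairs of nonzero velocities. -/
abbrev slit (E₁ E₂ : Type*) [Zero E₁] [Zero E₂] : Set (E₁ × E₂) := {0}ᶜ ×ˢ {0}ᶜ

theorem isOpen_slit : IsOpen (slit E₁ E₂) := isOpen_compl_singleton.prod isOpen_compl_singleton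

namespace IsTwistedProductOn

variable {b₁ : Module.Basis ι₁ ℝ E₁} {b₂ : Module.Basis ι₂ ℝ E₂} {T₁ : Set E₁}
    {T₂ : Set E₂} {F₁ : E₁ → E₁ → ℝ} {F₂ : E₂ → E₂ → ℝ} {h : E₁ × E₂ → ℝ}
    {F : E₁ × E₂ → E₁ × E₂ → ℝ} {z w : E₁ × E₂}

theorem dirDeriv_sq (hF : IsTwistedProductOn b₁ b₂ T₁ T₂ F₁ F₂ h F) (hz : z ∈ T₁ ×ˢ T₂)
    (hw : w ∈ slit E₁ E₂) (u : E₁ × E₂) :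
    dirDeriv u (fun w => F z w ^ 2) w = dirDeriv u.1 (fun y => F₁ z.1 y ^ 2) w.1 +
      h z * dirDeriv u.2 (fun y => F₂ z.2 y ^ 2) w.2 := by
  simp only [hF.sq z hz]
  have h1 := (hF.left.contDiffOn_sq_slice hz.1).differentiableAt_of_isOpen
    isOpen_compl_singleton hw.1
  have h2 := (hF.right.contDiffOn_sq_slice hz.2).differentiableAt_of_isOpen
    isOpen_compl_singleton hw.2
  rw [dirDeriv_add_prod (φ := fun y => F₁ z.1 y ^ 2) (ψ := fun v => h z * F₂ z.2 v ^ 2) h1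
    (h2.const_mul _), dirDeriv_const_mul]

theorem fundamentalTensor_eq (hF : IsTwistedProductOn b₁ b₂ T₁ T₂ F₁ F₂ h F) (hz : z ∈ T₁ ×ˢ T₂)
    (hw : w ∈ slit E₁ E₂) :
    fundamentalTensor (b₁.prod b₂) F z w =
      Matrix.fromBlocks (fundamentalTensor b₁ F₁ z.1 w.1) 0 0
        (h z • fundamentalTensor b₂ F₂ z.2 w.2) := by
  have h1 (u : E₁) := ((hF.left.contDiffOn_sq_slice hz.1).dirDeriv isOpen_compl_singleton
    u).differentiableAt_of_isOpen isOpen_compl_singleton hw.1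
  have h2 (u : E₂) := ((hF.right.contDiffOn_sq_slice hz.2).dirDeriv isOpen_compl_singleton
    u).differentiableAt_of_isOpen isOpen_compl_singleton hw.2
  have key (i j : ι₁ ⊕ ι₂) : fundamentalTensor (b₁.prod b₂) F z w i j =
      1 / 2 * (dirDeriv (b₁.prod b₂ j).1 (dirDeriv (b₁.prod b₂ i).1 fun y => F₁ z.1 y ^ 2) w.1 +
        h z * dirDeriv (b₁.prod b₂ j).2 (dirDeriv (b₁.prod b₂ i).2 fun y => F₂ z.2 y ^ 2) w.2) := by
    rw [fundamentalTensor_apply,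
      dirDeriv_congr isOpen_slit (fun w hw => hF.dirDeriv_sq hz hw (b₁.prod b₂ i)) _ hw,
      dirDeriv_add_prod (φ := dirDeriv _ _) (ψ := fun v => h z * dirDeriv _ _ v)
        (h1 _) ((h2 _).const_mul _), dirDeriv_const_mul]
  ext i j
  rw [key]
  rcases i with i | i <;> rcases j with j | j <;>
    simp [fundamentalTensor_apply]
  ring

theorem inv_fundamentalTensor_eq (hF : IsTwistedProductOn b₁ b₂ T₁ T₂ F₁ F₂ h F)
    (hz : z ∈ T₁ ×ˢ T₂) (hw : w ∈ slit E₁ E₂) :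
    (fundamentalTensor (b₁.prod b₂) F z w)⁻¹ =
      Matrix.fromBlocks (fundamentalTensor b₁ F₁ z.1 w.1)⁻¹ 0 0
        ((h z)⁻¹ • (fundamentalTensor b₂ F₂ z.2 w.2)⁻¹) := by
  rw [hF.fundamentalTensor_eq hz hw]
  refine Matrix.inv_eq_right_inv ?_
  have h0 := (hF.pos z hz).ne'
  simp [Matrix.fromBlocks_multiply, Matrix.mul_nonsing_inv _ (hF.left.det_ne_zero hz.1 hw.1).isUnit,
    Matrix.mul_nonsing_inv _ (hF.right.det_ne_zero hz.2 hw.2).isUnit, smul_smul, h0]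

theorem dx_sq (hF : IsTwistedProductOn b₁ b₂ T₁ T₂ F₁ F₂ h F) (hz : z ∈ T₁ ×ˢ T₂)
    (hw : w ∈ slit E₁ E₂) (u : E₁ × E₂) :
    dx u (fun z w => F z w ^ 2) z w = dx u.1 (fun x y => F₁ x y ^ 2) z.1 w.1 +
      (fderiv ℝ h z u * F₂ z.2 w.2 ^ 2 + h z * dx u.2 (fun x y => F₂ x y ^ 2) z.2 w.2) := by
  have h1 : HasFDerivAt (fun z : E₁ × E₂ => F₁ z.1 w.1 ^ 2) _ z :=
    ((contDiffOn_slice_left (Φ := fun x y => F₁ x y ^ 2) hF.left.contDiffOn_sq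
      hw.1).differentiableAt_of_isOpen hF.left.isOpen hz.1).hasFDerivAt.comp z hasFDerivAt_fst
  have h2 : HasFDerivAt (fun z : E₁ × E₂ => F₂ z.2 w.2 ^ 2) _ z :=
    ((contDiffOn_slice_left (Φ := fun x y => F₂ x y ^ 2) hF.right.contDiffOn_sq
      hw.2).differentiableAt_of_isOpen hF.right.isOpen hz.2).hasFDerivAt.comp z hasFDerivAt_snd
  have h3 := h1.fun_add ((hF.differentiableAt z hz).hasFDerivAt.fun_mul h2)
  unfold dx
  rw [(Filter.eventuallyEq_of_mem ((hF.left.isOpen.prod hF.right.isOpen).mem_nhds hz)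
    (fun z hz => hF.sq z hz w)).fderiv_eq, h3.fderiv]
  simp
  ring

theorem dy_dx_sq (hF : IsTwistedProductOn b₁ b₂ T₁ T₂ F₁ F₂ h F) (hz : z ∈ T₁ ×ˢ T₂)
    (hw : w ∈ slit E₁ E₂) (u u' : E₁ × E₂) :
    dy u' (dx u (fun z w => F z w ^ 2)) z w = dy u'.1 (dx u.1 (fun x y => F₁ x y ^ 2)) z.1 w.1 +
      (fderiv ℝ h z u * dirDeriv u'.2 (fun v => F₂ z.2 v ^ 2) w.2 +
        h z * dy u'.2 (dx u.2 (fun x y => F₂ x y ^ 2)) z.2 w.2) := by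
  have h1 := (hF.left.contDiffOn_dx_slice hz.1 u.1).differentiableAt_of_isOpen
    isOpen_compl_singleton hw.1
  have h2 := (hF.right.contDiffOn_dx_slice hz.2 u.2).differentiableAt_of_isOpen
    isOpen_compl_singleton hw.2
  have h3 := (hF.right.contDiffOn_sq_slice hz.2).differentiableAt_of_isOpen
    isOpen_compl_singleton hw.2
  rw [dy_eq_dirDeriv, dirDeriv_congr isOpen_slit (fun w hw => hF.dx_sq hz hw u) _ hw,
    dirDeriv_add_prod (φ := dx u.1 (fun x y => F₁ x y ^ 2) z.1) (ψ := fun v =>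
      fderiv ℝ h z u * F₂ z.2 v ^ 2 + h z * dx u.2 (fun x y => F₂ x y ^ 2) z.2 v) h1
      ((h3.const_mul _).fun_add (h2.const_mul _)),
    dirDeriv_add (h3.const_mul _) (h2.const_mul _), dirDeriv_const_mul, dirDeriv_const_mul]
  rfl

/-- `F₁²` is independent of the second position and `F₂²` of the first velocity, so the sole new
term comes from differentiating `h` along `M₁`. -/
theorem sprayCovector_inl (hF : IsTwistedProductOn b₁ b₂ T₁ T₂ F₁ F₂ h F) (hz : z ∈ T₁ ×ˢ T₂)
    (hw : w ∈ slit E₁ E₂) (p : ι₁) :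
    sprayCovector (b₁.prod b₂) F (Sum.inl p) z w =
      sprayCovector b₁ F₁ p z.1 w.1 - fderiv ℝ h z (b₁ p, 0) * F₂ z.2 w.2 ^ 2 := by
  unfold sprayCovector
  simp only [hF.dy_dx_sq hz hw, hF.dx_sq hz hw, Fintype.sum_sum_type, basis_prod_inl,
    basis_prod_inr, Module.Basis.prod_repr_inl, Module.Basis.prod_repr_inr]
  simp [dx_zero_dir, dy_eq_dirDeriv]
  ring

/-- The terms `h_q w^q`, summed over both factors, combine to `dh(w)`; this brings the first
velocity into the spray of the second factor. -/
theorem sprayCovector_inr (hF : IsTwistedProductOn b₁ b₂ T₁ T₂ F₁ F₂ h F) (hz : z ∈ T₁ ×ˢ T₂)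
    (hw : w ∈ slit E₁ E₂) (p : ι₂) :
    sprayCovector (b₁.prod b₂) F (Sum.inr p) z w =
      h z * sprayCovector b₂ F₂ p z.2 w.2 +
        fderiv ℝ h z w * dirDeriv (b₂ p) (fun v => F₂ z.2 v ^ 2) w.2 -
        fderiv ℝ h z (0, b₂ p) * F₂ z.2 w.2 ^ 2 := by
  have hsum : fderiv ℝ h z w = ∑ q, fderiv ℝ h z (b₁ q, 0) * b₁.repr w.1 q +
      ∑ q, fderiv ℝ h z (0, b₂ q) * b₂.repr w.2 q := by
    have := dirDeriv_eq_sum (b₁.prod b₂) w h z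
    simp only [dirDeriv, Fintype.sum_sum_type, basis_prod_inl, basis_prod_inr,
      Module.Basis.prod_repr_inl, Module.Basis.prod_repr_inr] at this
    simpa only [mul_comm] using this
  unfold sprayCovector
  simp only [hF.dy_dx_sq hz hw, hF.dx_sq hz hw, Fintype.sum_sum_type, basis_prod_inl,
    basis_prod_inr, Module.Basis.prod_repr_inl, Module.Basis.prod_repr_inr, hsum]
  have h1 (q : ι₁) : fderiv ℝ h z (b₁ q, 0) * dirDeriv (b₂ p) (fun v => F₂ z.2 v ^ 2) w.2 *
      b₁.repr w.1 q = fderiv ℝ h z (b₁ q, 0) * b₁.repr w.1 q *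
        dirDeriv (b₂ p) (fun v => F₂ z.2 v ^ 2) w.2 := by ring
  have h2 (q : ι₂) : (fderiv ℝ h z (0, b₂ q) * dirDeriv (b₂ p) (fun v => F₂ z.2 v ^ 2) w.2 +
      h z * dirDeriv (b₂ p) (dx (b₂ q) (fun x y => F₂ x y ^ 2) z.2) w.2) *
      b₂.repr w.2 q = fderiv ℝ h z (0, b₂ q) * b₂.repr w.2 q *
        dirDeriv (b₂ p) (fun v => F₂ z.2 v ^ 2) w.2 +
      h z * (dirDeriv (b₂ p) (dx (b₂ q) (fun x y => F₂ x y ^ 2) z.2) w.2 * b₂.repr w.2 q) := by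
    ring
  simp only [dx_zero_dir, dy_eq_dirDeriv, dirDeriv_zero_dir, dirDeriv_const, mul_zero, add_zero,
    zero_add, h1, h2, Finset.sum_add_distrib, ← Finset.mul_sum, ← Finset.sum_mul]
  ring

/-- The part of the spray coefficients of a twisted product that depends only on the velocity in
the second factor. -/
def _root_.Finsler.twistedSpray (b₂ : Module.Basis ι₂ ℝ E₂) (F₂ : E₂ → E₂ → ℝ) (h : E₁ × E₂ → ℝ)
    (z : E₁ × E₂) (α : ι₂) (v : E₂) : ℝ :=
  sprayCoeff b₂ F₂ α z.2 v + 1 / (2 * h z) * (fderiv ℝ h z (0, v) * b₂.repr v α) -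
    1 / (4 * h z) * (raise b₂ F₂ (fun p => fderiv ℝ h z (0, b₂ p)) z.2 α v * F₂ z.2 v ^ 2)

/-- The factor `1` is kept to present the coefficient as a sum of two products `φ(y) ψ(v)`, the form
required for triple differentiation; likewise in `sprayCoeff_inr`. -/
theorem sprayCoeff_inl (hF : IsTwistedProductOn b₁ b₂ T₁ T₂ F₁ F₂ h F) (hz : z ∈ T₁ ×ˢ T₂)
    (hw : w ∈ slit E₁ E₂) (i : ι₁) :
    sprayCoeff (b₁.prod b₂) F (Sum.inl i) z w = sprayCoeff b₁ F₁ i z.1 w.1 * 1 +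
      (-(1 / 4) * raise b₁ F₁ (fun p => fderiv ℝ h z (b₁ p, 0)) z.1 i w.1) * F₂ z.2 w.2 ^ 2 := by
  simp only [sprayCoeff_eq, hF.inv_fundamentalTensor_eq hz hw, Fintype.sum_sum_type,
    hF.sprayCovector_inl hz hw, raise]
  simp [mul_sub, Finset.sum_sub_distrib, Finset.mul_sum, Finset.sum_mul, mul_assoc]
  ring

theorem sprayCoeff_inr (hF : IsTwistedProductOn b₁ b₂ T₁ T₂ F₁ F₂ h F) (hz : z ∈ T₁ ×ˢ T₂)
    (hw : w ∈ slit E₁ E₂) (α : ι₂) :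
    sprayCoeff (b₁.prod b₂) F (Sum.inr α) z w = 1 * twistedSpray b₂ F₂ h z α w.2 +
      (1 / (2 * h z) * fderiv ℝ h z (w.1, 0)) * coordCLM b₂ α w.2 := by
  have h0 := (hF.pos z hz).ne'
  -- Separates `dh(w)` into its part in `y`, which multiplies `v^α`, and its part in `v`, which is
  -- absorbed into `twistedSpray`.
  have hsplit : fderiv ℝ h z w = fderiv ℝ h z (w.1, 0) + fderiv ℝ h z (0, w.2) := by
    rw [← map_add]; simp
  have he := hF.right.sum_inv_mul_dirDeriv hz.2 hw.2 α
  have hsum : ∑ p, (h z)⁻¹ * (fundamentalTensor b₂ F₂ z.2 w.2)⁻¹ α p *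
      sprayCovector (b₁.prod b₂) F (Sum.inr p) z w =
      ∑ p, (fundamentalTensor b₂ F₂ z.2 w.2)⁻¹ α p * sprayCovector b₂ F₂ p z.2 w.2 +
      (h z)⁻¹ * fderiv ℝ h z w * (2 * b₂.repr w.2 α) -
      (h z)⁻¹ * raise b₂ F₂ (fun p => fderiv ℝ h z (0, b₂ p)) z.2 α w.2 * F₂ z.2 w.2 ^ 2 := by
    rw [← he, raise, Finset.mul_sum, Finset.mul_sum, Finset.sum_mul, ← Finset.sum_add_distrib,
      ← Finset.sum_sub_distrib]
    refine Finset.sum_congr rfl fun p _ => ?_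
    rw [hF.sprayCovector_inr hz hw]
    field_simp
  have : sprayCoeff (b₁.prod b₂) F (Sum.inr α) z w =
      1 / 4 * ∑ p, (h z)⁻¹ * (fundamentalTensor b₂ F₂ z.2 w.2)⁻¹ α p *
        sprayCovector (b₁.prod b₂) F (Sum.inr p) z w := by
    simp [sprayCoeff_eq, hF.inv_fundamentalTensor_eq hz hw, Fintype.sum_sum_type]
  rw [this, hsum, twistedSpray, sprayCoeff_eq, hsplit, coordCLM_apply]
  field_simp
  ring

theorem contDiffOn_twistedSpray (hF : IsTwistedProductOn b₁ b₂ T₁ T₂ F₁ F₂ h F)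
    (hz : z ∈ T₁ ×ˢ T₂) (α : ι₂) : ContDiffOn ℝ ∞ (twistedSpray b₂ F₂ h z α) {0}ᶜ :=
  ((hF.right.contDiffOn_sprayCoeff hz.2 α).add (contDiffOn_const.mul
    (((fderiv ℝ h z).comp (ContinuousLinearMap.inr ℝ E₁ E₂)).contDiff.contDiffOn.mul
      (coordCLM b₂ α).contDiff.contDiffOn))).sub (contDiffOn_const.mul
        ((hF.right.contDiffOn_raise hz.2 _ α).mul (hF.right.contDiffOn_sq_slice hz.2)))

theorem landsbergCurvature_eq (hF : IsTwistedProductOn b₁ b₂ T₁ T₂ F₁ F₂ h F)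
    (hz : z ∈ T₁ ×ˢ T₂) (hw : w ∈ slit E₁ E₂) (i j k : ι₁ ⊕ ι₂) :
    landsbergCurvature (b₁.prod b₂) F i j k z w = -(1 / 4) *
      (∑ l, dirDeriv (b₁ l) (fun y => F₁ z.1 y ^ 2) w.1 *
        (derivLeft b₁ k (derivLeft b₁ j (derivLeft b₁ i (sprayCoeff b₁ F₁ l z.1))) w.1 *
          derivRight b₂ k (derivRight b₂ j (derivRight b₂ i fun _ => 1)) w.2 +
        derivLeft b₁ k (derivLeft b₁ j (derivLeft b₁ i fun y => -(1 / 4) *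
            raise b₁ F₁ (fun p => fderiv ℝ h z (b₁ p, 0)) z.1 l y)) w.1 *
          derivRight b₂ k (derivRight b₂ j (derivRight b₂ i fun v => F₂ z.2 v ^ 2)) w.2) +
      ∑ l, h z * dirDeriv (b₂ l) (fun v => F₂ z.2 v ^ 2) w.2 *
        (derivLeft b₁ k (derivLeft b₁ j (derivLeft b₁ i fun _ => 1)) w.1 *
          derivRight b₂ k (derivRight b₂ j (derivRight b₂ i (twistedSpray b₂ F₂ h z l))) w.2 +
        derivLeft b₁ k (derivLeft b₁ j (derivLeft b₁ i fun y => 1 / (2 * h z) *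
            (fderiv ℝ h z).comp (ContinuousLinearMap.inl ℝ E₁ E₂) y)) w.1 *
          derivRight b₂ k (derivRight b₂ j (derivRight b₂ i fun v => coordCLM b₂ l v)) w.2)) := by
  have hO₁ : IsOpen ({0}ᶜ : Set E₁) := isOpen_compl_singleton
  have hO₂ : IsOpen ({0}ᶜ : Set E₂) := isOpen_compl_singleton
  have h1 := (hF.left.contDiffOn_sq_slice hz.1).differentiableAt_of_isOpen hO₁ hw.1
  have h2 := (hF.right.contDiffOn_sq_slice hz.2).differentiableAt_of_isOpen hO₂ hw.2
  have hd : DifferentiableAt ℝ (fun w => F z w ^ 2) w := by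
    simp only [hF.sq z hz]
    exact (h1.comp w differentiableAt_fst).fun_add
      ((h2.comp w differentiableAt_snd).const_mul (h z))
  have hp : 0 < F z w ^ 2 := by
    rw [hF.sq z hz]
    exact add_pos (hF.left.sq_pos hz.1 hw.1) (mul_pos (hF.pos z hz) (hF.right.sq_pos hz.2 hw.2))
  rw [Finsler.landsbergCurvature_eq _ (hF.nonneg z hz) hd hp, Fintype.sum_sum_type]
  congr 2
  · refine Finset.sum_congr rfl fun l _ => ?_
    rw [hF.dirDeriv_sq hz hw, dirDeriv_dirDeriv_dirDeriv_tensor_add b₁ b₂ hO₁ hO₂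
      (hF.left.contDiffOn_sprayCoeff hz.1 l)
      (contDiffOn_const.mul (hF.left.contDiffOn_raise hz.1 _ l)) contDiffOn_const
      (hF.right.contDiffOn_sq_slice hz.2) (fun w hw => hF.sprayCoeff_inl hz hw l) i j k hw]
    simp
  · refine Finset.sum_congr rfl fun l _ => ?_
    rw [hF.dirDeriv_sq hz hw, dirDeriv_dirDeriv_dirDeriv_tensor_add b₁ b₂ hO₁ hO₂
      contDiffOn_const (contDiffOn_const.mul ((fderiv ℝ h z).comp
        (ContinuousLinearMap.inl ℝ E₁ E₂)).contDiff.contDiffOn) (hF.contDiffOn_twistedSpray hz l)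
      (coordCLM b₂ l).contDiff.contDiffOn (fun w hw => hF.sprayCoeff_inr hz hw l) i j k hw]
    simp

end IsTwistedProductOn

end LocalProduct

/-! ### Components of the curvature, and the local forms of sufficiency and necessity. -/

section LocalProductCurvature

variable {E₁ : Type*} [NormedAddCommGroup E₁] [NormedSpace ℝ E₁]
  {E₂ : Type*} [NormedAddCommGroup E₂] [NormedSpace ℝ E₂]
  {ι₁ : Type*} [Fintype ι₁] [DecidableEq ι₁] {ι₂ : Type*} [Fintype ι₂] [DecidableEq ι₂]

namespace DerivVanishOn

theorem of_basis {E : Type*} [NormedAddCommGroup E] [NormedSpace ℝ E] {ι : Type*} [Fintype ι]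
    [DecidableEq ι] (b : Module.Basis ι ℝ E) {V : Set E} {φ : E → ℝ}
    (h : ∀ i, ∀ y ∈ V, dirDeriv (b i) φ y = 0) : DerivVanishOn V 1 φ := by
  intro u y hy
  rw [dirDeriv_eq_sum b]
  exact Finset.sum_eq_zero fun i _ => by rw [h i y hy, mul_zero]

end DerivVanishOn

namespace IsFinslerOn

variable {E : Type*} [NormedAddCommGroup E] [NormedSpace ℝ E]
  {ι : Type*} [Fintype ι] [DecidableEq ι] {b : Module.Basis ι ℝ E} {T : Set E} {F : E → E → ℝ}
  {x y : E}

theorem landsbergCurvature_eq (hF : IsFinslerOn b T F) (hx : x ∈ T) (hy : y ≠ 0) (i j k : ι) :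
    landsbergCurvature b F i j k x y = -(1 / 4) * ∑ l, dirDeriv (b l) (fun y => F x y ^ 2) y *
      dirDeriv (b k) (dirDeriv (b j) (dirDeriv (b i) (sprayCoeff b F l x))) y :=
  Finsler.landsbergCurvature_eq b (hF.nonneg x hx)
    ((hF.contDiffOn_sq_slice hx).differentiableAt_of_isOpen isOpen_compl_singleton hy)
    (hF.sq_pos hx hy) i j k

theorem derivVanishOn_raise (hF : IsFinslerOn b T F) (hx : x ∈ T) {c : ι → ℝ}
    (h : ∀ y ≠ 0, ∀ i j, ∑ p, cartanTorsionRaised b F p i j x y * c p = 0) (l : ι) :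
    DerivVanishOn {0}ᶜ 1 (raise b F c x l) :=
  DerivVanishOn.of_basis b fun i y hy => hF.dirDeriv_raise_eq_zero hx hy (h y hy) i l

/-- If `F²` is quadratic in the velocity, then the Cartan torsion vanishes. -/
theorem _root_.Finsler.cartanTorsionRaised_eq_zero
    (h : DerivVanishOn {0}ᶜ 3 fun y => F x y ^ 2) (hy : y ≠ 0) (p i j : ι) :
    cartanTorsionRaised b F p i j x y = 0 := by
  refine Finset.sum_eq_zero fun k _ => ?_
  have : dy (b j) (fun x y => fundamentalTensor b F x y k i) x y = 0 := by
    simp only [fundamentalTensor_apply, dy_eq_dirDeriv, dirDeriv_const_mul]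
    rw [h (b k) (b i) (b j) y hy, mul_zero]
  rw [cartanTorsion, this, mul_zero, mul_zero]

/-- If `F²` is quadratic in the velocity, then so are the spray coefficients. -/
theorem derivVanishOn_sprayCoeff (hF : IsFinslerOn b T F)
    (h : ∀ x ∈ T, DerivVanishOn {0}ᶜ 3 fun y => F x y ^ 2) (hx : x ∈ T) (i : ι) :
    DerivVanishOn {0}ᶜ 3 (sprayCoeff b F i x) := by
  have hV : IsOpen ({0}ᶜ : Set E) := isOpen_compl_singleton
  -- A column of the inverse matrix is a raised unit covector, so vanishing torsion makes its
  -- entries independent of the velocity.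
  have hg (p : ι) : DerivVanishOn {0}ᶜ 1 fun y => (fundamentalTensor b F x y)⁻¹ i p := by
    have := hF.derivVanishOn_raise hx (c := Pi.single p 1) (fun y hy i j =>
      Finset.sum_eq_zero fun p _ => by rw [cartanTorsionRaised_eq_zero (h x hx) hy, zero_mul]) i
    refine this.congr hV fun y _ => ?_
    simp [raise, Pi.single_apply]
  have hdx (u : E) : DerivVanishOn {0}ᶜ 3 (dx u (fun x y => F x y ^ 2) x) :=
    DerivVanishOn.dx hF.isOpen hV (Φ := fun x y => F x y ^ 2) hF.contDiffOn_sq h u x hx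
  have hW (p : ι) : DerivVanishOn {0}ᶜ 3 (sprayCovector b F p x) :=
    DerivVanishOn.sub hV
      (ContDiffOn.sum fun q _ => ((hF.contDiffOn_dx_slice hx (b q)).dirDeriv hV (b p)).mul
        (coordCLM b q).contDiff.contDiffOn) (hF.contDiffOn_dx_slice hx (b p))
      (DerivVanishOn.sum hV (fun q _ => ((hF.contDiffOn_dx_slice hx (b q)).dirDeriv hV (b p)).mul
        (coordCLM b q).contDiff.contDiffOn) fun q _ => DerivVanishOn.mul hV (p := 1) (q := 1)
          ((hF.contDiffOn_dx_slice hx (b q)).dirDeriv hV (b p))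
          (coordCLM b q).contDiff.contDiffOn (hdx (b q) (b p)) (DerivVanishOn.clm (coordCLM b q)))
      (hdx (b p))
  exact DerivVanishOn.const_mul _ (DerivVanishOn.sum hV
    (fun p _ => (hF.contDiffOn_inv_slice hx i p).mul (hF.contDiffOn_sprayCovector hx p))
    fun p _ => DerivVanishOn.mul hV (p := 0) (q := 2) (hF.contDiffOn_inv_slice hx i p)
      (hF.contDiffOn_sprayCovector hx p) (hg p) (hW p))

end IsFinslerOn

namespace IsTwistedProductOn

variable {b₁ : Module.Basis ι₁ ℝ E₁} {b₂ : Module.Basis ι₂ ℝ E₂} {T₁ : Set E₁}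
    {T₂ : Set E₂} {F₁ : E₁ → E₁ → ℝ} {F₂ : E₂ → E₂ → ℝ} {h : E₁ × E₂ → ℝ}
    {F : E₁ × E₂ → E₁ × E₂ → ℝ} {z w : E₁ × E₂}

theorem derivVanishOn_twistedSpray (hF : IsTwistedProductOn b₁ b₂ T₁ T₂ F₁ F₂ h F)
    (h₂ : ∀ u ∈ T₂, DerivVanishOn {0}ᶜ 3 fun v => F₂ u v ^ 2) (hz : z ∈ T₁ ×ˢ T₂) (α : ι₂) :
    DerivVanishOn {0}ᶜ 3 (twistedSpray b₂ F₂ h z α) := by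
  have hV : IsOpen ({0}ᶜ : Set E₂) := isOpen_compl_singleton
  have hl := ((fderiv ℝ h z).comp (ContinuousLinearMap.inr ℝ E₁ E₂)).contDiff.contDiffOn
    (n := ∞) (s := {0}ᶜ)
  have hc := (coordCLM b₂ α).contDiff.contDiffOn (n := ∞) (s := {0}ᶜ)
  have hK := hF.right.contDiffOn_raise hz.2 (fun p => fderiv ℝ h z (0, b₂ p)) α
  have hQ := hF.right.contDiffOn_sq_slice hz.2
  have hG := hF.right.contDiffOn_sprayCoeff hz.2 α
  exact DerivVanishOn.sub hV (hG.add (contDiffOn_const.mul (hl.mul hc)))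
    (contDiffOn_const.mul (hK.mul hQ))
    (DerivVanishOn.add hV hG (contDiffOn_const.mul (hl.mul hc))
      (hF.right.derivVanishOn_sprayCoeff h₂ hz.2 α)
      (DerivVanishOn.const_mul _ (DerivVanishOn.mul hV (p := 1) (q := 1) hl hc
        (DerivVanishOn.clm ((fderiv ℝ h z).comp (ContinuousLinearMap.inr ℝ E₁ E₂)))
        (DerivVanishOn.clm (coordCLM b₂ α)))))
    (DerivVanishOn.const_mul _ (DerivVanishOn.mul hV (p := 0) (q := 2) hK hQ
      (hF.right.derivVanishOn_raise hz.2 (fun y hy i j => Finset.sum_eq_zero fun p _ => by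
        rw [cartanTorsionRaised_eq_zero (h₂ _ hz.2) hy, zero_mul]) α)
      (h₂ _ hz.2)))

/-- If `F₁` is a Landsberg metric whose Cartan torsion annihilates the differential of `h` and
`F₂²` is quadratic in the velocity, then the twisted product is a Landsberg metric. -/
theorem landsbergCurvature_eq_zero (hF : IsTwistedProductOn b₁ b₂ T₁ T₂ F₁ F₂ h F)
    (h₂ : ∀ u ∈ T₂, DerivVanishOn {0}ᶜ 3 fun v => F₂ u v ^ 2) (hz : z ∈ T₁ ×ˢ T₂)
    (hw : w ∈ slit E₁ E₂) (h₁ : ∀ i j k, landsbergCurvature b₁ F₁ i j k z.1 w.1 = 0)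
    (hC : ∀ y ≠ 0, ∀ i j, ∑ p, cartanTorsionRaised b₁ F₁ p i j z.1 y *
      fderiv ℝ h z (b₁ p, 0) = 0) (i j k : ι₁ ⊕ ι₂) :
    landsbergCurvature (b₁.prod b₂) F i j k z w = 0 := by
  have hV : IsOpen ({0}ᶜ : Set E₁) := isOpen_compl_singleton
  have hK1 := hF.left.derivVanishOn_raise hz.1 hC
  have hK2 (l) := (hK1 l).succ hV
  have hK3 (l) := (hK2 l).succ hV
  have hK1' (l i) := hK1 l (b₁ i) w.1 hw.1
  have hK2' (l i j) := hK2 l (b₁ i) (b₁ j) w.1 hw.1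
  have hK3' (l i j k) := hK3 l (b₁ i) (b₁ j) (b₁ k) w.1 hw.1
  have hQ (i j k) := h₂ z.2 hz.2 (b₂ i) (b₂ j) (b₂ k) w.2 hw.2
  have hR (α i j k) := hF.derivVanishOn_twistedSpray h₂ hz α (b₂ i) (b₂ j) (b₂ k) w.2 hw.2
  rw [hF.landsbergCurvature_eq hz hw]
  have hL (i j k) := h₁ i j k
  simp only [hF.left.landsbergCurvature_eq hz.1 hw.1] at hL
  -- With `K` constant in `y`, and `F₂²` and `twistedSpray` quadratic in `v`, every component
  -- vanishes termwise except the one with all indices on the left, which is that of `F₁`.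
  rcases i with i | i <;> rcases j with j | j <;> rcases k with k | k <;>
    simp only [derivLeft, derivRight, dirDeriv_const_mul, dirDeriv_const, dirDeriv_clm, hK1', hK2',
      hK3', hQ, hR, hL, mul_zero, zero_mul, add_zero, mul_one, Finset.sum_const_zero]

/-- The component of the Landsberg curvature in the directions of the first factor. -/
theorem landsbergCurvature_left (hF : IsTwistedProductOn b₁ b₂ T₁ T₂ F₁ F₂ h F)
    (hz : z ∈ T₁ ×ˢ T₂) (hw : w ∈ slit E₁ E₂)
    (hC : ∀ y ≠ 0, ∀ i j, ∑ p, cartanTorsionRaised b₁ F₁ p i j z.1 y *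
      fderiv ℝ h z (b₁ p, 0) = 0) (i j k : ι₁) :
    landsbergCurvature (b₁.prod b₂) F (Sum.inl i) (Sum.inl j) (Sum.inl k) z w =
      landsbergCurvature b₁ F₁ i j k z.1 w.1 := by
  have hV : IsOpen ({0}ᶜ : Set E₁) := isOpen_compl_singleton
  have hK3 (l) := (((hF.left.derivVanishOn_raise hz.1 hC l).succ hV).succ hV) (b₁ i) (b₁ j) (b₁ k)
    w.1 hw.1
  rw [hF.landsbergCurvature_eq hz hw, hF.left.landsbergCurvature_eq hz.1 hw.1]
  simp only [derivLeft, derivRight, dirDeriv_const_mul, dirDeriv_const, dirDeriv_clm, hK3,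
    mul_zero, zero_mul, add_zero, mul_one, Finset.sum_const_zero]

/-- The component of the Landsberg curvature in two directions of the first factor and one of the
second. -/
theorem landsbergCurvature_mixed (hF : IsTwistedProductOn b₁ b₂ T₁ T₂ F₁ F₂ h F)
    (hz : z ∈ T₁ ×ˢ T₂) (hw : w ∈ slit E₁ E₂) (i j : ι₁) (k : ι₂) :
    landsbergCurvature (b₁.prod b₂) F (Sum.inl i) (Sum.inl j) (Sum.inr k) z w =
      1 / 4 * dirDeriv (b₂ k) (fun v => F₂ z.2 v ^ 2) w.2 *
        ∑ p, cartanTorsionRaised b₁ F₁ p j i z.1 w.1 * fderiv ℝ h z (b₁ p, 0) := by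
  have hc := hF.left.cartanTorsionRaised_contract_eq hz.1 hw.1
    (fun p => fderiv ℝ h z (b₁ p, 0)) i j
  rw [hF.landsbergCurvature_eq hz hw]
  simp only [derivLeft, derivRight, dirDeriv_const_mul, dirDeriv_const, dirDeriv_clm,
    mul_zero, zero_mul, add_zero, zero_add, Finset.sum_const_zero]
  rw [show (1 / 4 : ℝ) * dirDeriv (b₂ k) (fun v => F₂ z.2 v ^ 2) w.2 *
        ∑ p, cartanTorsionRaised b₁ F₁ p j i z.1 w.1 * fderiv ℝ h z (b₁ p, 0) =
      1 / 16 * dirDeriv (b₂ k) (fun v => F₂ z.2 v ^ 2) w.2 *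
        (4 * ∑ p, cartanTorsionRaised b₁ F₁ p j i z.1 w.1 * fderiv ℝ h z (b₁ p, 0)) by ring, ← hc,
    Finset.mul_sum, Finset.mul_sum]
  exact Finset.sum_congr rfl fun l _ => by ring

/-- The component of the Landsberg curvature in the directions of the second factor. -/
theorem landsbergCurvature_right (hF : IsTwistedProductOn b₁ b₂ T₁ T₂ F₁ F₂ h F)
    (hz : z ∈ T₁ ×ˢ T₂) (hw : w ∈ slit E₁ E₂) (i j k : ι₂) :
    landsbergCurvature (b₁.prod b₂) F (Sum.inr i) (Sum.inr j) (Sum.inr k) z w =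
      1 / 8 * fderiv ℝ h z (w.1, 0) *
          dirDeriv (b₂ k) (dirDeriv (b₂ j) (dirDeriv (b₂ i) fun v => F₂ z.2 v ^ 2)) w.2 -
        1 / 4 * ∑ l, h z * dirDeriv (b₂ l) (fun v => F₂ z.2 v ^ 2) w.2 *
          dirDeriv (b₂ k) (dirDeriv (b₂ j) (dirDeriv (b₂ i) (twistedSpray b₂ F₂ h z l))) w.2 := by
  have hc := hF.left.sum_dirDeriv_mul_raise hz.1 hw.1 (fun p => fderiv ℝ h z (b₁ p, 0))
  have hsum : fderiv ℝ h z (w.1, 0) = ∑ q, fderiv ℝ h z (b₁ q, 0) * b₁.repr w.1 q := by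
    have := dirDeriv_eq_sum (b₁.prod b₂) (w.1, 0) h z
    simp only [dirDeriv, Fintype.sum_sum_type, basis_prod_inl, basis_prod_inr,
      Module.Basis.prod_repr_inl, Module.Basis.prod_repr_inr] at this
    simpa [mul_comm] using this
  rw [hF.landsbergCurvature_eq hz hw]
  simp only [derivLeft, derivRight, dirDeriv_const, dirDeriv_clm,
    mul_zero, add_zero, zero_add, one_mul]
  rw [show (1 / 8 : ℝ) * fderiv ℝ h z (w.1, 0) *
          dirDeriv (b₂ k) (dirDeriv (b₂ j) (dirDeriv (b₂ i) fun v => F₂ z.2 v ^ 2)) w.2 =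
      1 / 16 * dirDeriv (b₂ k) (dirDeriv (b₂ j) (dirDeriv (b₂ i) fun v => F₂ z.2 v ^ 2)) w.2 *
        (2 * fderiv ℝ h z (w.1, 0)) by ring, hsum, ← hc, mul_add, Finset.mul_sum, Finset.mul_sum,
    Finset.mul_sum, Finset.mul_sum, sub_eq_add_neg, ← Finset.sum_neg_distrib]
  exact congrArg₂ _ (Finset.sum_congr rfl fun l _ => by ring)
    (Finset.sum_congr rfl fun l _ => by ring)

/-- If the twisted product is a Landsberg metric, then the Cartan torsion of `F₁` annihilates the
differential of `h`. -/
theorem cartan_contract_eq_zero [Nonempty ι₂] (hF : IsTwistedProductOn b₁ b₂ T₁ T₂ F₁ F₂ h F)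
    (hz : z ∈ T₁ ×ˢ T₂)
    (hL : ∀ w ∈ slit E₁ E₂, ∀ i j k, landsbergCurvature (b₁.prod b₂) F i j k z w = 0)
    {y : E₁} (hy : y ≠ 0) (i j : ι₁) :
    ∑ p, cartanTorsionRaised b₁ F₁ p i j z.1 y * fderiv ℝ h z (b₁ p, 0) = 0 := by
  obtain ⟨α⟩ := ‹Nonempty ι₂›
  have hv : b₂ α ≠ 0 := b₂.ne_zero α
  -- At `v = b₂ α` Euler's identity gives the derivative `2 F₂²(v) > 0`, so the factor in front of
  -- the torsion term can be cancelled.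
  have hm : dirDeriv (b₂ α) (fun v => F₂ z.2 v ^ 2) (b₂ α) ≠ 0 := by
    have := hF.right.euler hz.2 hv
    rw [← dirDeriv_eq_sum] at this
    rw [this]
    exact (mul_pos two_pos (hF.right.sq_pos hz.2 hv)).ne'
  have h1 := hF.landsbergCurvature_mixed hz (w := (y, b₂ α)) ⟨hy, hv⟩ j i α
  rw [hL (y, b₂ α) ⟨hy, hv⟩] at h1
  simpa [hm] using h1.symm

/-- If the twisted product is a Landsberg metric and `h` is not stationary in the first factor,
then the third derivatives of `F₂²` vanish. -/
theorem dirDeriv_dirDeriv_dirDeriv_sq_eq_zero (hF : IsTwistedProductOn b₁ b₂ T₁ T₂ F₁ F₂ h F)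
    (hz : z ∈ T₁ ×ˢ T₂)
    (hL : ∀ w ∈ slit E₁ E₂, ∀ i j k, landsbergCurvature (b₁.prod b₂) F i j k z w = 0)
    {y : E₁} (hd : fderiv ℝ h z (y, 0) ≠ 0) {v : E₂} (hv : v ≠ 0) (i j k : ι₂) :
    dirDeriv (b₂ k) (dirDeriv (b₂ j) (dirDeriv (b₂ i) fun v => F₂ z.2 v ^ 2)) v = 0 := by
  have hy : y ≠ 0 := by rintro rfl; exact hd (map_zero _)
  have h1 := hF.landsbergCurvature_right hz (w := (y, v)) ⟨hy, hv⟩ i j k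
  -- Passing from `y` to `-y` changes the sign of the term with `dh(y)` and leaves the other term
  -- alone; subtraction isolates the former.
  have h2 := hF.landsbergCurvature_right hz (w := (-y, v)) ⟨neg_ne_zero.2 hy, hv⟩ i j k
  rw [hL (y, v) ⟨hy, hv⟩] at h1
  rw [hL (-y, v) ⟨neg_ne_zero.2 hy, hv⟩] at h2
  have hn : fderiv ℝ h z (-y, 0) = -fderiv ℝ h z (y, 0) := by rw [← map_neg]; simp
  dsimp only at h1 h2
  rw [hn] at h2
  have : fderiv ℝ h z (y, 0) *
      dirDeriv (b₂ k) (dirDeriv (b₂ j) (dirDeriv (b₂ i) fun v => F₂ z.2 v ^ 2)) v = 0 := by linarith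
  exact (mul_eq_zero.1 this).resolve_left hd

end IsTwistedProductOn

end LocalProductCurvature

/-! ### From vanishing third derivatives or reversibility to quadratic forms. -/

section Quadratic

variable {E : Type*} [NormedAddCommGroup E] [NormedSpace ℝ E]
  {ι : Type*} [Fintype ι] [DecidableEq ι] {b : Module.Basis ι ℝ E} {T : Set E} {F : E → E → ℝ}
  {x : E}

/-- In dimension at least two, `F²` is quadratic in the velocity as soon as its third derivatives
vanish on the slit tangent space. -/
theorem IsFinslerOn.exists_sq_eq_of_two_le (hF : IsFinslerOn b T F) (hx : x ∈ T)
    (hι : 2 ≤ Fintype.card ι)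
    (h : ∀ y ≠ 0, ∀ i j k,
      dirDeriv (b k) (dirDeriv (b j) (dirDeriv (b i) fun y => F x y ^ 2)) y = 0) :
    ∃ c : ι → ι → ℝ, ∀ y, F x y ^ 2 = ∑ i, ∑ j, c i j * b.repr y i * b.repr y j := by
  have hV : IsOpen ({0}ᶜ : Set E) := isOpen_compl_singleton
  -- Removing a point from a space of dimension at least two leaves it connected, so the locally
  -- constant `g_{ij}` is constant.
  have hrank : 1 < Module.rank ℝ E := by
    rw [rank_eq_card_basis b]; exact_mod_cast hι
  have hconn := (isConnected_compl_singleton_of_one_lt_rank hrank (0 : E)).isPreconnected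
  have hg (i j : ι) : ∃ c, ∀ y ∈ ({0}ᶜ : Set E), fundamentalTensor b F x y i j = c := by
    refine hV.exists_is_const_of_fderiv_eq_zero hconn
      ((hF.contDiffOn_fundamentalTensor_slice hx i j).differentiableOn (by simp)) fun y hy => ?_
    have h1 : DerivVanishOn {0}ᶜ 1 fun y => fundamentalTensor b F x y i j := by
      refine DerivVanishOn.of_basis b fun k y hy => ?_
      simp only [fundamentalTensor_apply, dirDeriv_const_mul]
      rw [h y hy, mul_zero]
    ext u
    exact h1 u y hy
  choose c hc using hg
  refine ⟨c, fun y => ?_⟩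
  rcases eq_or_ne y 0 with rfl | hy
  · simp [hF.map_zero hx]
  · rw [hF.sq_eq hx hy]
    simp only [hc _ _ y hy]

/-- In dimension one, reversibility implies that `F²` is quadratic in the velocity. -/
theorem IsFinslerOn.exists_sq_eq_of_reversible [Unique ι] (hF : IsFinslerOn b T F) (hx : x ∈ T)
    (hrev : ∀ y, F x (-y) = F x y) :
    ∃ c : ι → ι → ℝ, ∀ y, F x y ^ 2 = ∑ i, ∑ j, c i j * b.repr y i * b.repr y j := by
  refine ⟨fun _ _ => F x (b default) ^ 2, fun y => ?_⟩
  have hy : y = b.repr y default • b default := by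
    conv_lhs => rw [← b.sum_repr y]
    simp
  simp only [Finset.univ_unique, Finset.sum_singleton]
  generalize b.repr y default = t at hy
  subst hy
  rcases lt_trichotomy t 0 with ht | rfl | ht
  -- Homogeneity covers positive scalars only; reversibility carries the negative half-line to the
  -- positive one.
  · rw [← hrev, ← neg_smul, hF.homogeneous x hx _ _ (neg_pos.2 ht)]; ring
  · simp [hF.map_zero hx]
  · rw [hF.homogeneous x hx _ _ ht]; ring

/-- The third derivatives of a quadratic form vanish. -/
theorem derivVanishOn_of_sq_eq {V : Set E} (hV : IsOpen V) {φ : E → ℝ} {c : ι → ι → ℝ}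
    (h : ∀ y, φ y = ∑ i, ∑ j, c i j * b.repr y i * b.repr y j) : DerivVanishOn V 3 φ := by
  have hc (i : ι) := (coordCLM b i).contDiff.contDiffOn (n := ∞) (s := V)
  refine (DerivVanishOn.sum (s := Finset.univ) (n := 3) hV
    (fun i _ => ContDiffOn.sum (s := Finset.univ) fun j _ => contDiffOn_const.mul ((hc i).mul (hc j))) fun i _ => DerivVanishOn.sum hV (fun j _ =>
      contDiffOn_const.mul ((hc i).mul (hc j))) fun j _ => DerivVanishOn.const_mul (c i j)
        (DerivVanishOn.mul hV (p := 1) (q := 1) (hc i) (hc j) (DerivVanishOn.clm (coordCLM b i))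
          (DerivVanishOn.clm (coordCLM b j)))).congr hV fun y _ => ?_
  simp only [h, coordCLM_apply, mul_assoc]

end Quadratic

/-! ### Induced coordinates on the tangent bundle. -/

section TangentCoordinates

variable {E : Type*} [NormedAddCommGroup E] [NormedSpace ℝ E]

theorem contMDiff_mk_tangentBundle :
    ContMDiff 𝓘(ℝ, E × E) 𝓘(ℝ, E).tangent ∞
      fun p : E × E => (⟨p.1, p.2⟩ : TangentBundle 𝓘(ℝ, E) E) := by
  have := contMDiff_tangentBundleModelSpaceHomeomorph_symm (I := 𝓘(ℝ, E)) (n := ∞)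
  rw [modelWithCornersSelf_prod]
  exact this

variable {H : Type*} [TopologicalSpace H] (I : ModelWithCorners ℝ E H) [I.Boundaryless]
  {M : Type*} [TopologicalSpace M] [ChartedSpace H M] [IsManifold I ∞ M]

theorem mdifferentiableAt_extChartAt_symm {a : M} {x : E} (hx : x ∈ (extChartAt I a).target) :
    MDifferentiableAt 𝓘(ℝ, E) I (extChartAt I a).symm x := by
  have : IsManifold I 1 M := IsManifold.of_le (n := ∞) (by simp)
  exact ((contMDiffOn_extChartAt_symm (I := I) (n := 1) a).contMDiffAt
    ((isOpen_extChartAt_target a).mem_nhds hx)).mdifferentiableAt (by simp)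

theorem isInvertible_mfderiv_extChartAt_symm {a : M} {x : E} (hx : x ∈ (extChartAt I a).target) :
    (mfderiv 𝓘(ℝ, E) I (extChartAt I a).symm x).IsInvertible := by
  have : IsManifold I 1 M := IsManifold.of_le (n := ∞) (by simp)
  have := isInvertible_mfderivWithin_extChartAt_symm hx
  rwa [I.range_eq_univ, mfderivWithin_univ] at this

theorem contMDiffOn_coordVector (a : M) :
    ContMDiffOn 𝓘(ℝ, E × E) I.tangent ∞ (fun p : E × E => coordVector I a p.1 p.2)
      ((extChartAt I a).target ×ˢ Set.univ) := by
  have h1 := (contMDiffOn_extChartAt_symm (I := I) (n := ∞) a).contMDiffOn_tangentMapWithin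
    (m := ∞) (by simp) (isOpen_extChartAt_target a).uniqueMDiffOn
  refine ContMDiffOn.congr (h1.comp contMDiff_mk_tangentBundle.contMDiffOn fun p hp => hp.1)
    fun p hp => ?_
  exact (tangentMapWithin_eq_tangentMap (p := (⟨p.1, p.2⟩ : TangentBundle 𝓘(ℝ, E) E))
    ((isOpen_extChartAt_target a).uniqueMDiffOn _ hp.1)
    (mdifferentiableAt_extChartAt_symm I hp.1)).symm

theorem tangentBundle_mk_congr {p q : M} (h : p = q) (v : E) :
    (⟨p, v⟩ : TangentBundle I M) = ⟨q, v⟩ := by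
  subst h; rfl

theorem coordVector_snd_ne_zero {a : M} {x : E} (hx : x ∈ (extChartAt I a).target) (y : E) :
    (coordVector I a x y).snd ≠ 0 ↔ y ≠ 0 := by
  obtain ⟨A, hA⟩ := isInvertible_mfderiv_extChartAt_symm I hx
  change mfderiv 𝓘(ℝ, E) I (extChartAt I a).symm x y ≠ 0 ↔ y ≠ 0
  rw [← hA]
  exact A.map_eq_zero_iff.not

end TangentCoordinates

/-! ### From Finsler metrics on a manifold to their coordinate form and back. -/

section OneMetric

variable {n : ℕ} {M : Type*} [TopologicalSpace M]
  [ChartedSpace (EuclideanSpace ℝ (Fin n)) M] [IsManifold (𝓡 n) ∞ M]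

namespace FinslerMetric

theorem isFinslerOn (F : FinslerMetric n M) (a : M) :
    IsFinslerOn (stdBasis n) (extChartAt (𝓡 n) a).target (localRep (𝓡 n) F.toFun a) where
  isOpen := isOpen_extChartAt_target a
  nonneg _ _ _ := F.nonneg _
  smooth := by
    rw [← contMDiffOn_iff_contDiffOn]
    exact F.smooth.comp ((contMDiffOn_coordVector (𝓡 n) a).mono
      (Set.prod_mono_right (Set.subset_univ _)))
      fun p hp => (coordVector_snd_ne_zero (𝓡 n) hp.1 p.2).2 hp.2
  homogeneous x _ y c hc := by
    refine Eq.trans ?_ (F.homogeneous ((extChartAt (𝓡 n) a).symm x)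
      (mfderiv 𝓘(ℝ, EuclideanSpace ℝ (Fin n)) (𝓡 n) (extChartAt (𝓡 n) a).symm x y) c hc)
    exact congrArg (fun v => F.toFun ⟨_, v⟩) (ContinuousLinearMap.map_smul _ c y)
  posDef := F.posDef a

theorem isLandsberg_iff (F : FinslerMetric n M) :
    F.IsLandsberg ↔ ∀ a : M, ∀ x ∈ (extChartAt (𝓡 n) a).target, ∀ y ≠ 0, ∀ i j k,
      landsbergCurvature (stdBasis n) (localRep (𝓡 n) F.toFun a) i j k x y = 0 := by
  refine forall_congr' fun a => forall₂_congr fun x hx => forall_congr' fun y => ?_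
  exact imp_congr_left (coordVector_snd_ne_zero (𝓡 n) hx y)

/-- The coefficients are those of the symmetric bilinear form associated with `Q` pulled back along
the differential of the inverse chart. -/
theorem IsRiemannian.exists_sq_eq {F : FinslerMetric n M} (hF : F.IsRiemannian) (a : M)
    (x : EuclideanSpace ℝ (Fin n)) : ∃ c : Fin n → Fin n → ℝ, ∀ y,
      localRep (𝓡 n) F.toFun a x y ^ 2 =
        ∑ i, ∑ j, c i j * (stdBasis n).repr y i * (stdBasis n).repr y j := by
  obtain ⟨Q, hQ⟩ := hF ((extChartAt (𝓡 n) a).symm x)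
  set B : LinearMap.BilinForm ℝ (EuclideanSpace ℝ (Fin n)) := QuadraticMap.associated
    (Q.comp (mfderiv 𝓘(ℝ, EuclideanSpace ℝ (Fin n)) (𝓡 n) (extChartAt (𝓡 n) a).symm x).toLinearMap)
    with hB
  refine ⟨fun i j => B (stdBasis n i) (stdBasis n j), fun y => ?_⟩
  have h1 : localRep (𝓡 n) F.toFun a x y ^ 2 = B y y := by
    rw [hB, QuadraticMap.associated_eq_self_apply]
    exact hQ _
  rw [h1, ← LinearMap.sum_repr_mul_repr_mul (stdBasis n) (stdBasis n)]
  simp only [Finsupp.sum_fintype, smul_eq_mul, zero_mul, mul_zero, Finset.sum_const_zero,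
    implies_true]
  exact Finset.sum_congr rfl fun i _ => Finset.sum_congr rfl fun j _ => by ring

/-- Being Riemannian is pointwise, so each point need only be examined at the centre of its own
chart; the inverse of the chart differential carries the coordinate form to the tangent space. -/
theorem isRiemannian_of_exists_sq_eq {F : FinslerMetric n M}
    (h : ∀ a : M, ∃ c : Fin n → Fin n → ℝ, ∀ y,
      localRep (𝓡 n) F.toFun a (extChartAt (𝓡 n) a a) y ^ 2 =
        ∑ i, ∑ j, c i j * (stdBasis n).repr y i * (stdBasis n).repr y j) : F.IsRiemannian := by
  intro p
  obtain ⟨c, hc⟩ := h p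
  obtain ⟨A, hA⟩ := isInvertible_mfderiv_extChartAt_symm (𝓡 n) (mem_extChartAt_target (I := 𝓡 n) p)
  let L (i : Fin n) : TangentSpace (𝓡 n) p →ₗ[ℝ] ℝ := (stdBasis n).coord i ∘ₗ A.symm.toLinearMap
  refine ⟨∑ i, ∑ j, c i j • QuadraticMap.linMulLin (L i) (L j), fun v => ?_⟩
  have hv : coordVector (𝓡 n) p (extChartAt (𝓡 n) p p) (A.symm v) = ⟨p, v⟩ := by
    refine Eq.trans ?_ (tangentBundle_mk_congr (𝓡 n) (extChartAt_to_inv (I := 𝓡 n) p) v)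
    refine congrArg (fun w => (⟨_, w⟩ : TangentBundle (𝓡 n) M)) ?_
    rw [← hA]
    exact A.apply_symm_apply v
  rw [← hv]
  refine (hc _).trans ?_
  simp only [L, sum_apply, smul_apply, QuadraticMap.linMulLin_apply, smul_eq_mul,
    mul_assoc]
  rfl

theorem IsReversible.localRep_neg {F : FinslerMetric n M} (hF : F.IsReversible) (a : M)
    (x y : EuclideanSpace ℝ (Fin n)) :
    localRep (𝓡 n) F.toFun a x (-y) = localRep (𝓡 n) F.toFun a x y := by
  refine Eq.trans ?_ (hF ((extChartAt (𝓡 n) a).symm x)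
    (mfderiv 𝓘(ℝ, EuclideanSpace ℝ (Fin n)) (𝓡 n) (extChartAt (𝓡 n) a).symm x y))
  exact congrArg (fun v => F.toFun ⟨_, v⟩) (ContinuousLinearMap.map_neg _ y)

end FinslerMetric

end OneMetric

/-! ### The twisted product of manifolds in product charts. -/

section Product

variable {m n : ℕ} {M₁ : Type*} [TopologicalSpace M₁]
  [ChartedSpace (EuclideanSpace ℝ (Fin m)) M₁] [IsManifold (𝓡 m) ∞ M₁]
  {M₂ : Type*} [TopologicalSpace M₂]
  [ChartedSpace (EuclideanSpace ℝ (Fin n)) M₂] [IsManifold (𝓡 n) ∞ M₂]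
  {a : M₁ × M₂} {z : EuclideanSpace ℝ (Fin m) × EuclideanSpace ℝ (Fin n)}

theorem extChartAt_prod_target (a : M₁ × M₂) : (extChartAt ((𝓡 m).prod (𝓡 n)) a).target =
    (extChartAt (𝓡 m) a.1).target ×ˢ (extChartAt (𝓡 n) a.2).target := by
  rw [extChartAt_prod]; rfl

/-- Chain rule for the two sides of: projecting after the inverse product chart is the inverse chart
of the factor after projecting. -/
theorem tangentMap_fst_coordVector (hz : z ∈ (extChartAt ((𝓡 m).prod (𝓡 n)) a).target)
    (w : EuclideanSpace ℝ (Fin m) × EuclideanSpace ℝ (Fin n)) :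
    tangentMap ((𝓡 m).prod (𝓡 n)) (𝓡 m) Prod.fst (coordVector ((𝓡 m).prod (𝓡 n)) a z w) =
      coordVector (𝓡 m) a.1 z.1 w.1 := by
  have hz1 : z.1 ∈ (extChartAt (𝓡 m) a.1).target := by
    rw [extChartAt_prod_target] at hz; exact hz.1
  have he : Prod.fst ∘ (extChartAt ((𝓡 m).prod (𝓡 n)) a).symm =
      (extChartAt (𝓡 m) a.1).symm ∘ Prod.fst := by
    rw [extChartAt_prod]; rfl
  unfold coordVector
  rw [← tangentMap_comp_at (g := Prod.fst) (I' := (𝓡 m).prod (𝓡 n)) _ mdifferentiableAt_fst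
      (mdifferentiableAt_extChartAt_symm _ hz), he,
    tangentMap_comp_at (I' := 𝓘(ℝ, EuclideanSpace ℝ (Fin m))) _
      (mdifferentiableAt_extChartAt_symm _ hz1) (by exact differentiableAt_fst.mdifferentiableAt)]
  congr 1
  simp only [tangentMap, mfderiv_eq_fderiv]
  erw [fderiv_fst]
  rfl

theorem tangentMap_snd_coordVector (hz : z ∈ (extChartAt ((𝓡 m).prod (𝓡 n)) a).target)
    (w : EuclideanSpace ℝ (Fin m) × EuclideanSpace ℝ (Fin n)) :
    tangentMap ((𝓡 m).prod (𝓡 n)) (𝓡 n) Prod.snd (coordVector ((𝓡 m).prod (𝓡 n)) a z w) =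
      coordVector (𝓡 n) a.2 z.2 w.2 := by
  have hz2 : z.2 ∈ (extChartAt (𝓡 n) a.2).target := by
    rw [extChartAt_prod_target] at hz; exact hz.2
  have he : Prod.snd ∘ (extChartAt ((𝓡 m).prod (𝓡 n)) a).symm =
      (extChartAt (𝓡 n) a.2).symm ∘ Prod.snd := by
    rw [extChartAt_prod]; rfl
  unfold coordVector
  rw [← tangentMap_comp_at (g := Prod.snd) (I' := (𝓡 m).prod (𝓡 n)) _ mdifferentiableAt_snd
      (mdifferentiableAt_extChartAt_symm _ hz), he,
    tangentMap_comp_at (I' := 𝓘(ℝ, EuclideanSpace ℝ (Fin n))) _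
      (mdifferentiableAt_extChartAt_symm _ hz2) (by exact differentiableAt_snd.mdifferentiableAt)]
  congr 1
  simp only [tangentMap, mfderiv_eq_fderiv]
  erw [fderiv_snd]
  rfl

theorem coordVector_mem_slitProduct (hz : z ∈ (extChartAt ((𝓡 m).prod (𝓡 n)) a).target)
    (w : EuclideanSpace ℝ (Fin m) × EuclideanSpace ℝ (Fin n)) :
    coordVector ((𝓡 m).prod (𝓡 n)) a z w ∈ slitProduct m n M₁ M₂ ↔ w ∈ slit _ _ := by
  have hz' := hz
  rw [extChartAt_prod_target] at hz'
  unfold slitProduct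
  rw [Set.mem_ofPred_eq, tangentMap_fst_coordVector hz, tangentMap_snd_coordVector hz,
    coordVector_snd_ne_zero (𝓡 m) hz'.1, coordVector_snd_ne_zero (𝓡 n) hz'.2]
  rfl

/-- A function on `M₁ × M₂` in the product of the charts at the components of `a`. -/
def prodRep (f : M₁ × M₂ → ℝ) (a : M₁ × M₂)
    (z : EuclideanSpace ℝ (Fin m) × EuclideanSpace ℝ (Fin n)) : ℝ :=
  f ((extChartAt (𝓡 m) a.1).symm z.1, (extChartAt (𝓡 n) a.2).symm z.2)

theorem differentiableAt_prodRep {f : M₁ × M₂ → ℝ}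
    (hf : ContMDiff ((𝓡 m).prod (𝓡 n)) 𝓘(ℝ, ℝ) ∞ f)
    (hz : z ∈ (extChartAt ((𝓡 m).prod (𝓡 n)) a).target) : DifferentiableAt ℝ (prodRep f a) z := by
  have h := (hf.mdifferentiable (by simp) _).comp z (mdifferentiableAt_extChartAt_symm _ hz)
  rw [mdifferentiableAt_iff_differentiableAt] at h
  rw [extChartAt_prod] at h
  exact h

theorem fderiv_prodRep_sq {f : M₁ × M₂ → ℝ} (hf : DifferentiableAt ℝ (prodRep f a) z)
    (y : EuclideanSpace ℝ (Fin m)) :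
    fderiv ℝ (fun z => prodRep f a z ^ 2) z (y, 0) = 2 * prodRep f a z *
      fderiv ℝ (fun x => f ((extChartAt (𝓡 m) a.1).symm x, (extChartAt (𝓡 n) a.2).symm z.2)) z.1
        y := by
  have h1 := HasFDerivAt.comp (f := fun x => (x, z.2)) (g := prodRep f a) z.1
    (by exact hf.hasFDerivAt) (hasFDerivAt_prodMk_left z.1 z.2)
  have h2 : fderiv ℝ (fun x => f ((extChartAt (𝓡 m) a.1).symm x,
      (extChartAt (𝓡 n) a.2).symm z.2)) z.1 = _ := h1.fderiv
  rw [h2, (hf.hasFDerivAt.pow 2).fderiv]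
  simp

theorem isTwistedProductOn (F₁ : FinslerMetric m M₁) (F₂ : FinslerMetric n M₂) {f : M₁ × M₂ → ℝ}
    (hf : ContMDiff ((𝓡 m).prod (𝓡 n)) 𝓘(ℝ, ℝ) ∞ f) (hpos : ∀ x, 0 < f x) (a : M₁ × M₂) :
    IsTwistedProductOn (stdBasis m) (stdBasis n) (extChartAt (𝓡 m) a.1).target
      (extChartAt (𝓡 n) a.2).target (localRep (𝓡 m) F₁.toFun a.1) (localRep (𝓡 n) F₂.toFun a.2)
      (fun z => prodRep f a z ^ 2)
      (localRep ((𝓡 m).prod (𝓡 n)) (twistedProduct F₁ F₂ f) a) where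
  left := F₁.isFinslerOn a.1
  right := F₂.isFinslerOn a.2
  differentiableAt z hz := (differentiableAt_prodRep hf (by rwa [extChartAt_prod_target])).pow 2
  pos z _ := pow_pos (hpos _) 2
  nonneg _ _ _ := Real.sqrt_nonneg _
  sq z hz w := by
    rw [← extChartAt_prod_target] at hz
    unfold localRep twistedProduct
    rw [tangentMap_fst_coordVector hz, tangentMap_snd_coordVector hz, Real.sq_sqrt (by positivity)]
    congr 3

theorem twistedProductIsLandsberg_iff (F₁ : FinslerMetric m M₁) (F₂ : FinslerMetric n M₂)
    (f : M₁ × M₂ → ℝ) :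
    TwistedProductIsLandsberg F₁ F₂ f ↔ ∀ a : M₁ × M₂,
      ∀ z ∈ (extChartAt (𝓡 m) a.1).target ×ˢ (extChartAt (𝓡 n) a.2).target, ∀ w ∈ slit _ _,
        ∀ i j k, landsbergCurvature ((stdBasis m).prod (stdBasis n))
          (localRep ((𝓡 m).prod (𝓡 n)) (twistedProduct F₁ F₂ f) a) i j k z w = 0 := by
  refine forall_congr' fun a => ?_
  rw [← extChartAt_prod_target]
  refine forall₂_congr fun z hz => forall_congr' fun w => ?_
  exact imp_congr_left (coordVector_mem_slitProduct hz w)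

/-- At the centre of its chart, `mfderiv` is by definition the derivative of the coordinate
expression; nondifferentiability is excluded because it would give `mfderiv` the default value zero.
-/
theorem exists_fderiv_ne_zero {f : M₁ → ℝ} {p : M₁} (h : mfderiv (𝓡 m) 𝓘(ℝ, ℝ) f p ≠ 0) :
    ∃ y, fderiv ℝ (fun x => f ((extChartAt (𝓡 m) p).symm x)) (extChartAt (𝓡 m) p p) y ≠ 0 := by
  by_contra! h0
  refine h ?_
  by_cases hd : MDifferentiableAt (𝓡 m) 𝓘(ℝ, ℝ) f p
  · rw [hd.mfderiv, (𝓡 m).range_eq_univ, fderivWithin_univ]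
    ext y
    exact h0 y
  · exact mfderiv_zero_of_not_mdifferentiableAt hd

end Product

end Finsler

end

/-! ### The theorem. -/

theorem theorem4p3 {m n : ℕ}
    {M₁ : Type*} [TopologicalSpace M₁] [ChartedSpace (EuclideanSpace ℝ (Fin m)) M₁]
    [IsManifold (𝓡 m) ∞ M₁]
    {M₂ : Type*} [TopologicalSpace M₂] [ChartedSpace (EuclideanSpace ℝ (Fin n)) M₂]
    [IsManifold (𝓡 n) ∞ M₂] [Nonempty M₂]
    (F₁ : Finsler.FinslerMetric m M₁) (F₂ : Finsler.FinslerMetric n M₂) (f : M₁ × M₂ → ℝ)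
    (hf : ContMDiff ((𝓡 m).prod (𝓡 n)) 𝓘(ℝ, ℝ) ∞ f) (hpos : ∀ x, 0 < f x) :
    (F₁.IsLandsberg ∧ F₂.IsRiemannian ∧ Finsler.CartanContractionVanishes F₁ f →
      Finsler.TwistedProductIsLandsberg F₁ F₂ f) ∧
    ((2 ≤ n ∨ (n = 1 ∧ F₂.IsReversible)) →
      (∀ q : M₂, ∃ p : M₁, mfderiv (𝓡 m) 𝓘(ℝ, ℝ) (fun p' => f (p', q)) p ≠ 0) →
      (Finsler.TwistedProductIsLandsberg F₁ F₂ f ↔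
        F₁.IsLandsberg ∧ F₂.IsRiemannian ∧ Finsler.CartanContractionVanishes F₁ f)) := by
  have hT := Finsler.isTwistedProductOn F₁ F₂ hf hpos
  have hdiff (a : M₁ × M₂) {z} (hz : z ∈ (extChartAt (𝓡 m) a.1).target ×ˢ
      (extChartAt (𝓡 n) a.2).target) : DifferentiableAt ℝ (Finsler.prodRep f a) z :=
    Finsler.differentiableAt_prodRep hf (by rwa [Finsler.extChartAt_prod_target])
  -- Used with `k = 2f`: since `h = f²`, the differentials of `h` and `f` along `M₁` differ by this
  -- nonzero factor.
  have hsum (A d : Fin m → ℝ) (k : ℝ) : ∑ p, A p * (k * d p) = k * ∑ p, A p * d p := by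
    rw [Finset.mul_sum]
    exact Finset.sum_congr rfl fun p _ => mul_left_comm _ _ _
  have hsuff : F₁.IsLandsberg ∧ F₂.IsRiemannian ∧ Finsler.CartanContractionVanishes F₁ f →
      Finsler.TwistedProductIsLandsberg F₁ F₂ f := by
    rintro ⟨h₁, h₂, h₃⟩
    rw [Finsler.FinslerMetric.isLandsberg_iff] at h₁
    rw [Finsler.twistedProductIsLandsberg_iff]
    intro a z hz w hw i j k
    refine (hT a).landsbergCurvature_eq_zero (fun u _ => ?_) hz hw (h₁ a.1 z.1 hz.1 w.1 hw.1)
      (fun y hy i j => ?_) i j k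
    · obtain ⟨c, hc⟩ := h₂.exists_sq_eq a.2 u
      exact Finsler.derivVanishOn_of_sq_eq isOpen_compl_singleton hc
    · have h := h₃ ((extChartAt (𝓡 n) a.2).symm z.2) a.1 z.1 hz.1 y hy i j
      simp only [Finsler.fderiv_prodRep_sq (hdiff a hz)]
      rw [hsum]
      exact mul_eq_zero_of_right _ h
  refine ⟨hsuff, fun hn hf' => ⟨fun hL => ?_, hsuff⟩⟩
  rw [Finsler.twistedProductIsLandsberg_iff] at hL
  have : Nonempty (Fin n) := ⟨⟨0, by omega⟩⟩
  -- The point `q` is represented by the centre of its own chart, so the inverse chart returns `q`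
  -- itself and the coordinate expression of `f` becomes `f(·, q)`.
  have hmem (q : M₂) {a : M₁} {x} (hx : x ∈ (extChartAt (𝓡 m) a).target) :
      (x, extChartAt (𝓡 n) q q) ∈ (extChartAt (𝓡 m) (a, q).1).target ×ˢ
        (extChartAt (𝓡 n) (a, q).2).target := ⟨hx, mem_extChartAt_target q⟩
  have hC (q : M₂) (a : M₁) (x) (hx : x ∈ (extChartAt (𝓡 m) a).target) (y) (hy : y ≠ 0) (i j) :=
    (hT (a, q)).cartan_contract_eq_zero (hmem q hx) (hL _ _ (hmem q hx)) hy i j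
  refine ⟨?_, ?_, ?_⟩
  · rw [Finsler.FinslerMetric.isLandsberg_iff]
    intro a x hx y hy i j k
    obtain ⟨q⟩ := ‹Nonempty M₂›
    obtain ⟨α⟩ := ‹Nonempty (Fin n)›
    have hw : (y, Finsler.stdBasis n α) ∈ Finsler.slit (EuclideanSpace ℝ (Fin m))
        (EuclideanSpace ℝ (Fin n)) := ⟨hy, (Finsler.stdBasis n).ne_zero α⟩
    exact ((hT (a, q)).landsbergCurvature_left (hmem q hx) hw (hC q a x hx) i j k).symm.trans
      (hL _ _ (hmem q hx) _ hw _ _ _)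
  · refine Finsler.FinslerMetric.isRiemannian_of_exists_sq_eq fun q => ?_
    obtain ⟨p, hp⟩ := hf' q
    obtain ⟨y, hy⟩ := Finsler.exists_fderiv_ne_zero hp
    have hz := hmem q (mem_extChartAt_target (I := 𝓡 m) p)
    rcases hn with hn | ⟨rfl, hrev⟩
    · refine (F₂.isFinslerOn q).exists_sq_eq_of_two_le hz.2 (by simpa using hn) fun v hv i j k => ?_
      refine (hT (p, q)).dirDeriv_dirDeriv_dirDeriv_sq_eq_zero hz (hL _ _ hz) (y := y) ?_ hv i j k
      rw [Finsler.fderiv_prodRep_sq (hdiff _ hz)]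
      refine mul_ne_zero (mul_ne_zero two_ne_zero (hpos _).ne') ?_
      simpa only [extChartAt_to_inv] using hy
    · exact (F₂.isFinslerOn q).exists_sq_eq_of_reversible hz.2 (hrev.localRep_neg q _)
  · intro q a x hx y hy i j
    have h := hC q a x hx y hy i j
    simp only [Finsler.fderiv_prodRep_sq (hdiff _ (hmem q hx))] at h
    simp only [extChartAt_to_inv] at h
    rw [hsum] at h
    exact (mul_eq_zero.1 h).resolve_left (mul_ne_zero two_ne_zero (hpos _).ne')
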